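/- **Setting.** Let $V$ and $H$ be real separable Hilbert spaces with $V$ continuously, injectively and densely embedded in $H$, so that $V\hookrightarrow H\cong H^*\hookrightarrow V^*$ (here $v\in V$ is identified with the functional $w\mapsto\langle v,w\rangle_H$ in $V^*$), let $\mathcal H$ be a real Hilbert space, and let $T>0$. Put $\mathcal V:=L^2(0,T;V)$ with dual $\mathcal V^*=L^2(0,T;V^*)$ and $W(0,T;V):=\{y\in\mathcal V : y_t\in\mathcal V^*\}$, where $y_t$ is the derivative in the sense of $V^*$-valued distributions on $(0,T)$. For $y\in W(0,T;V)$ and $s\in[0,T]$, $y(s)\in H$ denotes the value at $s$ of the representative of $y$ that is continuous from $[0,T]$ to $H$. For $t\in(0,T]$ let $a(t;\cdot,\cdot)$ be a bilinear form on $V$ such that, with constants $c,\gamma>0$ independent of $t$, $|a(t;\varphi,\psi)|\le c\|\varphi\|_V\|\psi\|_V$ and $a(t;\psi,\psi)\ge\gamma\|\psi\|_V^2$ for all $\varphi,\psi\in V$, and such that $t\mapsto a(t;\varphi,\psi)$ is (Lebesgue) measurable on $(0,T]$ for all $\varphi,\psi\in V$. Let $\mathcal A(t),\mathcal A^*(t):V\to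 V^*$ be defined by $a(t;\varphi,\psi)=\langle\mathcal A(t)\varphi,\psi\rangle_{V^*,V}=\langle\mathcal A^*(t)\psi,\varphi\rangle_{V^*,V}$. Let $f\in\mathcal V^*$, let $C:\mathcal V\to\mathcal H$ be bounded and linear with adjoint $C^*:\mathcal H^*\to\mathcal V^*$, let $\Lambda:\mathcal H\to\mathcal H^*$ be the Riesz isomorphism, let $y^{(d)}\in\mathcal H$, $y^{(b)}\in H$, $\alpha>0$, and let $U_{\rm ad}\subseteq H$ be nonempty, closed and convex. **Theorem (Optimality system).** For every $v\in H$ there is exactly one $y(v)\in W(0,T;V)$ with $$y_t(v)+\mathcal A(t)y(v)=f\ \text{ in }\mathcal V^*,\qquad y(0;v)=v\ \text{ in }H,$$ and exactly one $p(v)\in W(0,T;V)$ with $$-p_t(v)+\mathcal A^*(t)p(v)=C^*\Lambda\bigl(Cy(v)-y^{(d)}\bigr)\ \text{ in }\mathcal V^*,\qquad p(T;v)=0\ \text{ in }H,$$ and the value $p(0;v)\in H$ of $p(v)$ at time $0$ exists and is unique. The optimal control problem $$\min_{v\in U_{\rm ad}}J(v),\qquad J(v):=\tfrac12\bigl\|Cy(v)-y^{(d)}\bigr\|_{\mathcal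 H}^2+\tfrac{\alpha}{2}\bigl\|v-y^{(b)}\bigr\|_H^2,$$ has exactly one solution $u\in U_{\rm ad}$. An element $u\in U_{\rm ad}$ is this solution if and only if $$\langle p(0;u)+\alpha(u-y^{(b)}),\,v-u\rangle_H\ge0\qquad\text{for all }v\in U_{\rm ad}.$$ -/

import Mathlib

open MeasureTheory Set
open scoped RealInnerProductSpace ContDiff ENNReal

noncomputable section

namespace InitialControl

/-- Lebesgue measure on the time interval `(0,T]`. -/
abbrev timeMeasure (T : ℝ) : Measure ℝ := volume.restrict (Ioc 0 T)

/-- The Bochner space `L²(0,T;E)` (equivalence classes of functions). -/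
abbrev L2 (T : ℝ) (E : Type*) [NormedAddCommGroup E] : Type _ := Lp E 2 (timeMeasure T)

section

variable {V H Y : Type*}
  [NormedAddCommGroup V] [InnerProductSpace ℝ V]
  [NormedAddCommGroup H] [InnerProductSpace ℝ H]
  [NormedAddCommGroup Y] [InnerProductSpace ℝ Y]

/-- The embedding `V ↪ H = H* ↪ V*` of an evolution triple with embedding `j : V ↪ H`:
`v` is sent to the functional `w ↦ ⟪j v, j w⟫_H`. -/
def gelfand (j : V →L[ℝ] H) : V →L[ℝ] StrongDual ℝ V :=
  (innerSL ℝ : H →L[ℝ] H →L[ℝ] ℝ).bilinearComp j j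

/-- The duality pairing between `L²(0,T;V*)` and `L²(0,T;V)`. -/
def pairing {T : ℝ} (z : L2 T (StrongDual ℝ V)) (φ : L2 T V) : ℝ :=
  ∫ t, z t (φ t) ∂(timeMeasure T)

/-- `z ∈ L²(0,T;V*)` is the time derivative `y_t`, in the sense of `V*`-valued distributions
on `(0,T)`, of `y ∈ L²(0,T;V)`. -/
def IsTimeDeriv {T : ℝ} (j : V →L[ℝ] H) (y : L2 T V) (z : L2 T (StrongDual ℝ V)) : Prop :=
  ∀ φ : ℝ → ℝ, ContDiff ℝ ∞ φ → HasCompactSupport φ → tsupport φ ⊆ Ioo 0 T →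
    ∫ t, deriv φ t • gelfand j (y t) ∂(timeMeasure T) =
      -∫ t, φ t • z t ∂(timeMeasure T)

/-- `y(s) = h` in `H`: the representative of `y` that is continuous on `[0,T]` with values
in `H` takes the value `h` at the time `s ∈ [0,T]`. -/
def HasTrace {T : ℝ} (j : V →L[ℝ] H) (y : L2 T V) (s : ℝ) (h : H) : Prop :=
  ∃ g : ℝ → H, ContinuousOn g (Icc 0 T) ∧ (∀ᵐ t ∂(timeMeasure T), g t = j (y t)) ∧ g s = h

/-- `y ∈ W(0,T;V)` solves `y_t + 𝒜(t) y = f` in the dual of `L²(0,T;V)` and `y(0) = v` in `H`,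
where `𝒜(t) φ = a t φ ∈ V*`. -/
def IsState {T : ℝ} (j : V →L[ℝ] H) (a : ℝ → V →L[ℝ] StrongDual ℝ V)
    (f : L2 T (StrongDual ℝ V)) (v : H) (y : L2 T V) : Prop :=
  (∃ y' : L2 T (StrongDual ℝ V), IsTimeDeriv j y y' ∧
    ∀ φ : L2 T V,
      pairing y' φ + ∫ t, a t (y t) (φ t) ∂(timeMeasure T) = pairing f φ) ∧
  HasTrace j y 0 v

/-- `p ∈ W(0,T;V)` solves the adjoint equation `-p_t + 𝒜*(t) p = C* Λ (C y - yd)` in the dual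
of `L²(0,T;V)` and `p(T) = 0` in `H`. Here `⟨C* Λ h, φ⟩ = ⟪h, C φ⟫` and
`⟨𝒜*(t) ψ, φ⟩ = ⟨𝒜(t) φ, ψ⟩`. -/
def IsAdjoint {T : ℝ} (j : V →L[ℝ] H) (a : ℝ → V →L[ℝ] StrongDual ℝ V)
    (C : L2 T V →L[ℝ] Y) (yd : Y) (y p : L2 T V) : Prop :=
  (∃ p' : L2 T (StrongDual ℝ V), IsTimeDeriv j p p' ∧
    ∀ φ : L2 T V,
      -pairing p' φ + ∫ t, (a t).flip (p t) (φ t) ∂(timeMeasure T) = ⟪C y - yd, C φ⟫) ∧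
  HasTrace j p T 0

/-- The objective `J(v) = ½ ‖C y(v) - yd‖² + α/2 ‖v - yb‖²`, for the control-to-state map
`v ↦ y(v)`. -/
def cost {T : ℝ} (C : L2 T V →L[ℝ] Y) (yd : Y) (α : ℝ) (yb : H) (y : H → L2 T V) (v : H) : ℝ :=
  1 / 2 * ‖C (y v) - yd‖ ^ 2 + α / 2 * ‖v - yb‖ ^ 2

end

end InitialControl

end

/-! ### Du Bois-Reymond lemma for vector-valued functions -/

section DuBoisReymond

variable {E : Type*} [NormedAddCommGroup E] [NormedSpace ℝ E] [CompleteSpace E]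

/-! The state depends affinely on the control, y(v) = y₀ + S v with S bounded and linear, so J is a
strictly convex quadratic functional and minimising it is a nearest-point problem in a product
Hilbert space (`existsUnique_isMinOn_quadratic`). The projection inequality says J'(u)(v - u) ≥ 0.
The adjoint state represents the first part of this derivative: on integrating p(u) by parts against
S w, only the boundary term at 0 survives because p(T;u) = 0, the operator terms cancel, and
⟨p(0;u), w⟩ = ⟨C y(u) - yd, C S w⟩.

Two analytic facts carry this. The first is the embedding of W(0,T;V) into C([0,T];H) with its
energy identity (`IsTimeDeriv.exists_continuousOn`); polarisation turns the identity into
integration by parts. No mollification is used. By du Bois-Reymond, y is a.e. a primitive of its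
derivative z in V*, so ‖y(t+h)‖² - ‖y(t)‖² is the integral of z(t+σ) applied to y(t+h) + y(t) over 0
< σ < h. Averaging in t, dividing by h and using continuity of translations in L² gives the identity
at almost all pairs of times, and a local estimate then extends y continuously to [0,T].

The second is well-posedness of σ y' + B y = F with y given at one end (`exists_solution`,
`IsSolution.unique`). Existence follows from Lions' projection theorem, uniqueness from the energy
identity and coercivity. The sign σ = ±1 treats the forward state and the backward adjoint equation
together. -/

theorem integral_deriv_mul_primitive {T : ℝ} {z θ : ℝ → ℝ}
    (hz : IntervalIntegrable z volume 0 T) (hθ : ContDiff ℝ ∞ θ) (hθT : θ T = 0) :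
    ∫ t in 0..T, deriv θ t * ∫ s in 0..t, z s = -∫ t in 0..T, θ t * z t := by
  have h := AbsolutelyContinuousOnInterval.integral_mul_deriv_eq_deriv_mul
    (f := θ) (g := fun t => ∫ s in 0..t, z s) (a := 0) (b := T)
    (ContDiffOn.absolutelyContinuousOnInterval (hθ.of_le (by simp)).contDiffOn)
    (hz.absolutelyContinuousOnInterval_intervalIntegral left_mem_uIcc)
  have h2 : ∫ t in 0..T, θ t * deriv (fun t => ∫ s in 0..t, z s) t = ∫ t in 0..T, θ t * z t := by
    refine intervalIntegral.integral_congr_ae ?_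
    filter_upwards [hz.ae_hasDerivAt_integral] with t ht hm
    rw [(ht (uIoc_subset_uIcc hm) 0 left_mem_uIcc).deriv]
  rw [h2, hθT] at h
  simp only [intervalIntegral.integral_same, zero_mul, mul_zero, sub_zero, zero_sub] at h
  linarith

/-- Continuous functionals separate points and commute with the integral, so the scalar case
suffices. -/
theorem integral_deriv_smul_primitive {T : ℝ} {z : ℝ → E} {θ : ℝ → ℝ}
    (hz : IntervalIntegrable z volume 0 T) (hθ : ContDiff ℝ ∞ θ) (hθT : θ T = 0) :
    ∫ t in 0..T, deriv θ t • ∫ s in 0..t, z s = -∫ t in 0..T, θ t • z t := by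
  refine (SeparatingDual.eq_iff_forall_dual_eq (R := ℝ)).2 fun ℓ => ?_
  have hc : ContinuousOn (fun t => ∫ s in 0..t, z s) (uIcc 0 T) :=
    intervalIntegral.continuousOn_primitive_interval' hz left_mem_uIcc
  have hθ' : Continuous (deriv θ) := hθ.continuous_deriv (by simp)
  have i1 : IntervalIntegrable (fun t => deriv θ t • ∫ s in 0..t, z s) volume 0 T :=
    (hθ'.continuousOn.smul hc).intervalIntegrable
  have i2 : IntervalIntegrable (fun t => θ t • z t) volume 0 T :=
    hz.continuousOn_smul hθ.continuous.continuousOn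
  rw [map_neg, ← ℓ.intervalIntegral_comp_comm i1, ← ℓ.intervalIntegral_comp_comm i2]
  have hℓ : IntervalIntegrable (fun t => ℓ (z t)) volume 0 T :=
    ⟨ℓ.integrable_comp hz.1, ℓ.integrable_comp hz.2⟩
  have := integral_deriv_mul_primitive hℓ hθ hθT
  simp only [map_smul, smul_eq_mul]
  rw [← this]
  refine intervalIntegral.integral_congr fun t ht => ?_
  have : IntervalIntegrable z volume 0 t := hz.mono_set (uIcc_subset_uIcc left_mem_uIcc ht)
  simp only [ℓ.intervalIntegral_comp_comm this]

theorem exists_Icc_subset_Ioo_of_isCompact {a b : ℝ} (hab : a < b) {K : Set ℝ} (hK : IsCompact K)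
    (hKs : K ⊆ Ioo a b) : ∃ c d, a < c ∧ d < b ∧ K ⊆ Icc c d := by
  rcases K.eq_empty_or_nonempty with rfl | hne
  · exact ⟨b, a, hab, hab, empty_subset _⟩
  · exact ⟨sInf K, sSup K, (hKs (hK.sInf_mem hne)).1, (hKs (hK.sSup_mem hne)).2,
      fun x hx => ⟨csInf_le hK.bddBelow hx, le_csSup hK.bddAbove hx⟩⟩

/-- A test function on `(0,T)` with vanishing integral is the derivative of a test function. -/
theorem exists_test_function_deriv_eq {T : ℝ} (hT : 0 < T) {θ : ℝ → ℝ} (hθ : ContDiff ℝ ∞ θ)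
    (hc : HasCompactSupport θ) (hs : tsupport θ ⊆ Ioo 0 T) (h0 : ∫ t in 0..T, θ t = 0) :
    ∃ ψ : ℝ → ℝ, ContDiff ℝ ∞ ψ ∧ HasCompactSupport ψ ∧ tsupport ψ ⊆ Ioo 0 T ∧ deriv ψ = θ := by
  obtain ⟨c, d, hc0, hdT, hsub⟩ := exists_Icc_subset_Ioo_of_isCompact hT hc hs
  have hz : ∀ t, t ∉ Icc c d → θ t = 0 := fun t ht => by
    by_contra h
    exact ht (hsub (subset_tsupport θ h))
  have hii : ∀ x y, IntervalIntegrable θ volume x y := fun x y =>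
    hθ.continuous.intervalIntegrable x y
  have hd : ∀ t, HasDerivAt (fun t => ∫ s in 0..t, θ s) (θ t) t := fun t =>
    intervalIntegral.integral_hasDerivAt_right (hii _ _)
      (hθ.continuous.stronglyMeasurableAtFilter _ _) hθ.continuous.continuousAt
  have hde : deriv (fun t => ∫ s in 0..t, θ s) = θ := funext fun t => (hd t).deriv
  have hsupp : tsupport (fun t => ∫ s in 0..t, θ s) ⊆ Icc c d := by
    refine closure_minimal (fun t ht => ?_) isClosed_Icc
    by_contra hn
    refine ht ?_
    -- Before c the primitive integrates only zeros. After d it is the total integral minus an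
    -- integral of zeros, and the total vanishes by `h0`.
    rcases lt_or_ge t c with h | h
    · refine (intervalIntegral.integral_congr (g := fun _ => (0 : ℝ)) fun x hx => ?_).trans (by simp)
      refine hz x fun hx' => ?_
      have := hx.2
      have h3 : max 0 t < c := max_lt hc0 h
      linarith [hx'.1]
    · have h : d < t := by
        by_contra h'
        exact hn ⟨h, not_lt.mp h'⟩
      have h1 := intervalIntegral.integral_add_adjacent_intervals (hii 0 t) (hii t T)
      have h2 : ∫ s in t..T, θ s = 0 := by
        refine (intervalIntegral.integral_congr (g := fun _ => (0 : ℝ)) fun x hx => ?_).trans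
          (by simp)
        refine hz x fun hx' => ?_
        have := hx.1
        have h3 : d < min t T := lt_min h hdT
        linarith [hx'.2]
      simp only
      linarith
  refine ⟨_, contDiff_infty_iff_deriv.2 ⟨fun t => (hd t).differentiableAt, by rwa [hde]⟩,
    HasCompactSupport.of_support_subset_isCompact isCompact_Icc (subset_closure.trans hsupp),
    hsupp.trans fun x hx => ⟨hc0.trans_le hx.1, hx.2.trans_lt hdT⟩, hde⟩

theorem exists_test_function_integral_eq_one {T : ℝ} (hT : 0 < T) :
    ∃ θ : ℝ → ℝ, ContDiff ℝ ∞ θ ∧ HasCompactSupport θ ∧ tsupport θ ⊆ Ioo 0 T ∧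
      ∫ t in 0..T, θ t = 1 := by
  let b : ContDiffBump (T / 2) := ⟨T / 8, T / 4, by positivity, by linarith⟩
  have hs : tsupport (b.normed volume) ⊆ Ioo 0 T := by
    rw [b.tsupport_normed_eq, Real.closedBall_eq_Icc]
    exact fun x hx => ⟨by linarith [hx.1, show b.rOut = T / 4 from rfl],
      by linarith [hx.2, show b.rOut = T / 4 from rfl]⟩
  refine ⟨b.normed volume, b.contDiff_normed, b.hasCompactSupport_normed, hs, ?_⟩
  rw [intervalIntegral.integral_of_le hT.le, setIntegral_eq_integral_of_forall_compl_eq_zero,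
    b.integral_normed]
  intro x hx
  by_contra h
  exact hx (Ioo_subset_Ioc_self (hs (subset_tsupport _ h)))

/-- **Du Bois-Reymond lemma**: a function with an integrable distributional derivative on `(0,T)`
is a.e. equal to a primitive of it. -/
theorem ae_eq_const_add_primitive {T : ℝ} (hT : 0 < T) {u z : ℝ → E}
    (hu : IntegrableOn u (Ioc 0 T)) (hz : IntegrableOn z (Ioc 0 T))
    (h : ∀ θ : ℝ → ℝ, ContDiff ℝ ∞ θ → HasCompactSupport θ → tsupport θ ⊆ Ioo 0 T →
      ∫ t in Ioc 0 T, deriv θ t • u t = -∫ t in Ioc 0 T, θ t • z t) :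
    ∃ ξ : E, ∀ᵐ t ∂(volume.restrict (Ioc 0 T)), u t = ξ + ∫ s in 0..t, z s := by
  simp only [← intervalIntegral.integral_of_le hT.le] at h
  have hu' : IntervalIntegrable u volume 0 T := (intervalIntegrable_iff_integrableOn_Ioc_of_le hT.le).2 hu
  have hz' : IntervalIntegrable z volume 0 T := (intervalIntegrable_iff_integrableOn_Ioc_of_le hT.le).2 hz
  -- The difference w has zero distributional derivative; it remains to see that it is a.e.
  -- constant.
  set w : ℝ → E := fun t => u t - ∫ s in 0..t, z s with hw
  have hc : ContinuousOn (fun t => ∫ s in 0..t, z s) (uIcc 0 T) :=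
    intervalIntegral.continuousOn_primitive_interval' hz' left_mem_uIcc
  have hwi : IntervalIntegrable w volume 0 T := hu'.sub hc.intervalIntegrable
  have hsi : ∀ θ : ℝ → ℝ, Continuous θ → IntervalIntegrable (fun t => θ t • w t) volume 0 T :=
    fun θ hθ => hwi.continuousOn_smul hθ.continuousOn
  have hder : ∀ θ : ℝ → ℝ, ContDiff ℝ ∞ θ → HasCompactSupport θ → tsupport θ ⊆ Ioo 0 T →
      ∫ t in 0..T, deriv θ t • w t = 0 := fun θ hθ hθc hθs => by
    have hθ' : Continuous (deriv θ) := hθ.continuous_deriv (by simp)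
    have hθT : θ T = 0 := by
      by_contra hne
      exact lt_irrefl T (hθs (subset_tsupport θ hne)).2
    have i1 : IntervalIntegrable (fun t => deriv θ t • ∫ s in 0..t, z s) volume 0 T :=
      (hθ'.continuousOn.smul hc).intervalIntegrable
    simp only [hw, smul_sub]
    rw [intervalIntegral.integral_sub (hu'.continuousOn_smul hθ'.continuousOn) i1, h θ hθ hθc hθs,
      integral_deriv_smul_primitive hz' hθ hθT, sub_self]
  obtain ⟨θ₀, hθ₀, hθ₀c, hθ₀s, hθ₀1⟩ := exists_test_function_integral_eq_one hT
  set ξ : E := ∫ t in 0..T, θ₀ t • w t with hξ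
  have key : ∀ θ : ℝ → ℝ, ContDiff ℝ ∞ θ → HasCompactSupport θ → tsupport θ ⊆ Ioo 0 T →
      ∫ t in 0..T, θ t • (w t - ξ) = 0 := fun θ hθ hθc hθs => by
    set κ : ℝ := ∫ t in 0..T, θ t with hκ
    have i1 : IntervalIntegrable (fun t => κ * θ₀ t) volume 0 T :=
      (continuous_const.mul hθ₀.continuous).intervalIntegrable _ _
    have i2 : IntervalIntegrable (fun t => κ • θ₀ t • w t) volume 0 T :=
      (hsi _ hθ₀.continuous).smul κ
    have i3 : IntervalIntegrable (fun t => θ t • ξ) volume 0 T :=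
      (hθ.continuous.smul continuous_const).intervalIntegrable _ _
    -- Subtracting κ θ₀ makes the mean of θ zero, so the result is an admissible derivative and is
    -- annihilated by w. Hence θ pairs with w as it does with the constant ξ.
    obtain ⟨ψ, h1, h2, h3, h4⟩ := exists_test_function_deriv_eq hT
      (θ := fun t => θ t - κ * θ₀ t)
      (hθ.sub (contDiff_const.mul hθ₀)) (hθc.sub (hθ₀c.mul_left))
      ((tsupport_sub _ _).trans (union_subset hθs ((tsupport_mul_subset_right).trans hθ₀s))) (by
        rw [intervalIntegral.integral_sub (hθ.continuous.intervalIntegrable _ _) i1,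
          intervalIntegral.integral_const_mul, hθ₀1, mul_one, sub_self])
    have h5 := hder ψ h1 h2 h3
    simp only [h4, sub_smul, mul_smul] at h5
    rw [intervalIntegral.integral_sub (hsi _ hθ.continuous) i2, intervalIntegral.integral_smul, ← hξ] at h5
    simp only [smul_sub]
    rw [intervalIntegral.integral_sub (hsi _ hθ.continuous) i3,
      intervalIntegral.integral_smul_const, ← hκ, h5]
  refine ⟨ξ, ?_⟩
  have hloc : LocallyIntegrableOn (fun t => w t - ξ) (Ioo 0 T) :=
    (((intervalIntegrable_iff_integrableOn_Ioc_of_le hT.le).1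
      (hwi.sub (_root_.intervalIntegrable_const))).mono_set Ioo_subset_Ioc_self).locallyIntegrableOn
  have hae := isOpen_Ioo.ae_eq_zero_of_integral_contDiff_smul_eq_zero hloc fun θ hθ hθc hθs => by
    rw [← key θ hθ hθc hθs, intervalIntegral.integral_of_le hT.le,
      setIntegral_eq_integral_of_forall_compl_eq_zero]
    intro x hx
    have : θ x = 0 := by
      by_contra hne
      exact hx (Ioo_subset_Ioc_self (hθs (subset_tsupport θ hne)))
    rw [this, zero_smul]
  rw [← restrict_Ioo_eq_restrict_Ioc, ae_restrict_iff' measurableSet_Ioo]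
  filter_upwards [hae] with t ht hm
  have := ht hm
  rw [hw] at this
  simp only at this
  rw [sub_sub, sub_eq_zero] at this
  rw [this, add_comm]

end DuBoisReymond

/-! ### Translations in L² and the averaged energy balance -/

section Translation

open Filter Topology

theorem continuous_addRight_curry : Continuous fun σ : ℝ =>
    (⟨fun t => t + σ, continuous_add_const σ⟩ : C(ℝ, ℝ)) :=
  (ContinuousMap.mk (fun a : ℝ × ℝ => a.2 + a.1) (by fun_prop)).curry.continuous

theorem continuous_translate_Lp {V : Type*} [NormedAddCommGroup V]
    (f : Lp V 2 (volume : Measure ℝ)) : Continuous fun σ : ℝ =>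
    Lp.compMeasurePreserving (fun t => t + σ) (measurePreserving_add_right volume σ) f :=
  Continuous.compMeasurePreservingLp (continuous_const (y := f)) continuous_addRight_curry
    (fun σ => measurePreserving_add_right volume σ) (by simp)

variable {V : Type*} [NormedAddCommGroup V] [NormedSpace ℝ V]

/-- Translation is continuous in `L²`, so the duality pairing of translates is continuous. -/
theorem tendsto_setIntegral_translate {y : ℝ → V} {z : ℝ → StrongDual ℝ V}
    (hy : MemLp y 2 volume) (hz : MemLp z 2 volume) (S : Set ℝ) :
    Tendsto (fun q : ℝ × ℝ => ∫ t in S, z (t + q.1) (y (t + q.2) + y t)) (𝓝 (0, 0))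
      (𝓝 (∫ t in S, z t (y t + y t))) := by
  let B : StrongDual ℝ V →L[ℝ] V →L[ℝ] ℝ := ContinuousLinearMap.id ℝ _
  let τV : ℝ → Lp V 2 (volume : Measure ℝ) := fun σ =>
    Lp.compMeasurePreserving (fun t => t + σ) (measurePreserving_add_right volume σ) (hy.toLp y)
  let τD : ℝ → Lp (StrongDual ℝ V) 2 (volume : Measure ℝ) := fun σ =>
    Lp.compMeasurePreserving (fun t => t + σ) (measurePreserving_add_right volume σ) (hz.toLp z)
  have hτ : ∀ σ, τV σ =ᵐ[volume] fun t => y (t + σ) := fun σ =>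
    (Lp.coeFn_compMeasurePreserving _ _).trans
      ((measurePreserving_add_right volume σ).quasiMeasurePreserving.ae_eq_comp hy.coeFn_toLp)
  have hτD : ∀ σ, τD σ =ᵐ[volume] fun t => z (t + σ) := fun σ =>
    (Lp.coeFn_compMeasurePreserving _ _).trans
      ((measurePreserving_add_right volume σ).quasiMeasurePreserving.ae_eq_comp hz.coeFn_toLp)
  let K : ℝ × ℝ → ℝ := fun q => B.lpPairing (volume.restrict S) 2 2
    (LpToLpRestrictCLM ℝ _ ℝ volume 2 S (τD q.1))
    (LpToLpRestrictCLM ℝ _ ℝ volume 2 S (τV q.2 + hy.toLp y))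
  have hK : Continuous K := by
    have h1 : Continuous τV := continuous_translate_Lp _
    have h2 : Continuous τD := continuous_translate_Lp _
    fun_prop
  have hKe : ∀ q, K q = ∫ t in S, z (t + q.1) (y (t + q.2) + y t) := fun q => by
    simp only [K, ContinuousLinearMap.lpPairing_eq_integral]
    refine integral_congr_ae ?_
    filter_upwards [LpToLpRestrictCLM_coeFn ℝ S (τD q.1),
      LpToLpRestrictCLM_coeFn ℝ S (τV q.2 + hy.toLp y), ae_restrict_of_ae (hτD q.1),
      ae_restrict_of_ae (hτ q.2), ae_restrict_of_ae hy.coeFn_toLp,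
      ae_restrict_of_ae (Lp.coeFn_add (τV q.2) (hy.toLp y))] with t h1 h2 h3 h4 h5 h6
    rw [h1, h2, h3, h6, Pi.add_apply, h4, h5]
    rfl
  have := hK.tendsto (0, 0)
  rw [hKe] at this
  simp only [add_zero] at this
  exact this.congr hKe

theorem norm_apply_le_sq_add_sq (f : StrongDual ℝ V) (v : V) : ‖f v‖ ≤ ‖f‖ ^ 2 + ‖v‖ ^ 2 := by
  have := f.le_opNorm v
  nlinarith [sq_nonneg (‖f‖ - ‖v‖), sq_nonneg ‖f‖, sq_nonneg ‖v‖]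

theorem stronglyMeasurable_dual_apply {X : Type*} [MeasurableSpace X] {f : X → StrongDual ℝ V}
    {g : X → V} (hf : StronglyMeasurable f) (hg : StronglyMeasurable g) :
    StronglyMeasurable fun x => f x (g x) :=
  isBoundedBilinearMap_apply.continuous.comp_stronglyMeasurable (hf.prodMk hg)

theorem integrable_dual_apply {X : Type*} [MeasurableSpace X] {μ : Measure X}
    {f : X → StrongDual ℝ V} {g : X → V} (hf : MemLp f 2 μ) (hg : MemLp g 2 μ) :
    Integrable (fun x => f x (g x)) μ := by
  refine Integrable.mono' (hf.norm.integrable_sq.add hg.norm.integrable_sq) ?_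
    (Eventually.of_forall fun x => norm_apply_le_sq_add_sq _ _)
  exact isBoundedBilinearMap_apply.continuous.comp_aestronglyMeasurable (hf.1.prodMk hg.1)

/-- Justifies Fubini: translation invariance bounds the inner integral of the norm by ‖z‖² + ‖w‖² in
L², uniformly in the shift. Genuine strong measurability of z makes z(t + σ) jointly measurable. -/
theorem integrable_prod_translate {z : ℝ → StrongDual ℝ V} {w : ℝ → V}
    (hz : MemLp z 2 volume) (hzm : StronglyMeasurable z)
    (hw : MemLp w 2 volume) (hwm : StronglyMeasurable w) (S : Set ℝ) (a b : ℝ) :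
    Integrable (fun q : ℝ × ℝ => z (q.1 + q.2) (w q.1))
      ((volume.restrict S).prod (volume.restrict (Ioc a b))) := by
  have hm : StronglyMeasurable fun q : ℝ × ℝ => z (q.1 + q.2) (w q.1) :=
    stronglyMeasurable_dual_apply (hzm.comp_measurable (measurable_fst.add measurable_snd))
      (hwm.comp_measurable measurable_fst)
  have hzs : ∀ σ : ℝ, MemLp (fun t => z (t + σ)) 2 volume := fun σ =>
    hz.comp_measurePreserving (measurePreserving_add_right volume σ)
  have hi : ∀ σ : ℝ, Integrable (fun t => z (t + σ) (w t)) volume := fun σ =>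
    integrable_dual_apply (hzs σ) hw
  rw [integrable_prod_iff' hm.aestronglyMeasurable]
  refine ⟨Eventually.of_forall fun σ => (hi σ).restrict, ?_⟩
  have hnm : StronglyMeasurable fun σ => ∫ t in S, ‖z (t + σ) (w t)‖ :=
    hm.norm.integral_prod_left'
  refine Integrable.mono' (integrable_const ((∫ t, ‖z t‖ ^ 2) + ∫ t, ‖w t‖ ^ 2))
    hnm.aestronglyMeasurable (Eventually.of_forall fun σ => ?_)
  rw [Real.norm_of_nonneg (integral_nonneg fun t => norm_nonneg _)]
  calc ∫ t in S, ‖z (t + σ) (w t)‖ ≤ ∫ t, ‖z (t + σ) (w t)‖ :=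
        setIntegral_le_integral (hi σ).norm (Eventually.of_forall fun t => norm_nonneg _)
    _ ≤ ∫ t, (‖z (t + σ)‖ ^ 2 + ‖w t‖ ^ 2) :=
        integral_mono (hi σ).norm ((hzs σ).norm.integrable_sq.add hw.norm.integrable_sq)
          fun t => norm_apply_le_sq_add_sq _ _
    _ = (∫ t, ‖z t‖ ^ 2) + ∫ t, ‖w t‖ ^ 2 := by
        rw [integral_add (hzs σ).norm.integrable_sq hw.norm.integrable_sq,
          integral_add_right_eq_self (fun t => ‖z t‖ ^ 2)]

/-- After Fubini the quantity is an average over 0 < σ ≤ h of a function of the two shifts (σ, h)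
that is jointly continuous at the origin. -/
theorem tendsto_average_translate {y : ℝ → V} {z : ℝ → StrongDual ℝ V}
    (hy : MemLp y 2 volume) (hym : StronglyMeasurable y)
    (hz : MemLp z 2 volume) (hzm : StronglyMeasurable z) (S : Set ℝ) :
    Tendsto (fun h : ℝ => h⁻¹ * ∫ t in S, ∫ σ in 0..h, z (t + σ) (y (t + h) + y t)) (𝓝[>] 0)
      (𝓝 (∫ t in S, z t (y t + y t))) := by
  rw [Metric.tendsto_nhdsWithin_nhds]
  intro ε hε
  obtain ⟨δ, hδ, hK⟩ := Metric.tendsto_nhds_nhds.1 (tendsto_setIntegral_translate hy hz S)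
    (ε / 2) (half_pos hε)
  refine ⟨δ, hδ, fun {h} hh hhd => ?_⟩
  have hh : 0 < h := hh
  have hhd : h < δ := by simpa [abs_of_pos hh] using hhd
  set I := ∫ t in S, z t (y t + y t)
  have hyh : MemLp (fun t => y (t + h) + y t) 2 volume :=
    (hy.comp_measurePreserving (measurePreserving_add_right volume h)).add hy
  have hyhm : StronglyMeasurable (fun t => y (t + h) + y t) :=
    (hym.comp_measurable (by fun_prop)).add hym
  have hint := integrable_prod_translate hz hzm hyh hyhm S 0 h
  have hswap : ∫ t in S, ∫ σ in 0..h, z (t + σ) (y (t + h) + y t) =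
      ∫ σ in 0..h, ∫ t in S, z (t + σ) (y (t + h) + y t) := by
    simp only [intervalIntegral.integral_of_le hh.le]
    exact integral_integral_swap hint
  have hKi : IntervalIntegrable (fun σ => ∫ t in S, z (t + σ) (y (t + h) + y t)) volume 0 h :=
    (intervalIntegrable_iff_integrableOn_Ioc_of_le hh.le).2 hint.integral_prod_right
  have hb : ‖∫ σ in 0..h, ((∫ t in S, z (t + σ) (y (t + h) + y t)) - I)‖ ≤ ε / 2 * |h - 0| := by
    refine intervalIntegral.norm_integral_le_of_norm_le_const fun σ hσ => ?_
    rw [uIoc_of_le hh.le] at hσ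
    refine (hK (x := (σ, h)) ?_).le
    rw [Prod.dist_eq, max_lt_iff, Real.dist_0_eq_abs, Real.dist_0_eq_abs, abs_of_pos hh,
      abs_of_pos hσ.1]
    exact ⟨hσ.2.trans_lt hhd, hhd⟩
  rw [intervalIntegral.integral_sub hKi _root_.intervalIntegrable_const,
    intervalIntegral.integral_const, sub_zero, abs_of_pos hh, smul_eq_mul] at hb
  rw [hswap, Real.dist_eq]
  have he : h⁻¹ * (∫ σ in 0..h, ∫ t in S, z (t + σ) (y (t + h) + y t)) - I =
      h⁻¹ * ((∫ σ in 0..h, ∫ t in S, z (t + σ) (y (t + h) + y t)) - h * I) := by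
    field_simp
  rw [he, abs_mul, abs_of_pos (inv_pos.2 hh)]
  calc _ ≤ h⁻¹ * (ε / 2 * h) := mul_le_mul_of_nonneg_left hb (inv_pos.2 hh).le
    _ = ε / 2 := by field_simp
    _ < ε := half_lt_self hε

/-- Integrate the increment relation over (s, r], divide by h and let h decrease to 0. The left side
tends to Φ r - Φ s because s and r are differentiation points of the primitive of Φ. -/
theorem sub_eq_integral_of_steklov {y : ℝ → V} {z : ℝ → StrongDual ℝ V} {Φ : ℝ → ℝ}
    (hy : MemLp y 2 volume) (hym : StronglyMeasurable y)
    (hz : MemLp z 2 volume) (hzm : StronglyMeasurable z) (hΦ : Integrable Φ) {s r δ : ℝ}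
    (hsr : s ≤ r) (hδ : 0 < δ)
    (h : ∀ h ∈ Ioo 0 δ, ∀ᵐ t ∂(volume.restrict (Ioc s r)),
      Φ (t + h) - Φ t = ∫ σ in 0..h, z (t + σ) (y (t + h) + y t))
    (hs : HasDerivAt (fun x => ∫ t in 0..x, Φ t) (Φ s) s)
    (hr : HasDerivAt (fun x => ∫ t in 0..x, Φ t) (Φ r) r) :
    Φ r - Φ s = 2 * ∫ t in s..r, z t (y t) := by
  have h1 := hr.tendsto_slope_zero_right.sub hs.tendsto_slope_zero_right
  have h2 := tendsto_average_translate hy hym hz hzm (Ioc s r)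
  have hii : ∀ a b, IntervalIntegrable Φ volume a b := fun a b => hΦ.intervalIntegrable
  have h3 : ∫ t in Ioc s r, z t (y t + y t) = 2 * ∫ t in s..r, z t (y t) := by
    rw [intervalIntegral.integral_of_le hsr, ← integral_const_mul]
    simp only [map_add, two_mul]
  rw [h3] at h2
  refine tendsto_nhds_unique (h1.congr' ?_) h2
  filter_upwards [Ioo_mem_nhdsGT hδ] with x hx
  -- The integral of Φ(t + x) - Φ(t) over (s, r] telescopes to the integrals of Φ over (r, r + x]
  -- minus (s, s + x].
  rw [← integral_congr_ae (h x hx), ← intervalIntegral.integral_of_le hsr,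
    intervalIntegral.integral_sub (hΦ.comp_add_right x).intervalIntegrable (hii _ _),
    intervalIntegral.integral_comp_add_right]
  have e1 := intervalIntegral.integral_add_adjacent_intervals (hii 0 (s + x)) (hii (s + x) (r + x))
  have e2 := intervalIntegral.integral_add_adjacent_intervals (hii 0 s) (hii s r)
  simp only [smul_eq_mul]
  rw [← e1, ← e2]
  ring

end Translation

namespace InitialControl

/-! ### Embedding of W(0,T;V) into C([0,T];H) -/

section Embedding

open Filter Topology

variable {V H : Type*}
  [NormedAddCommGroup V] [InnerProductSpace ℝ V]
  [NormedAddCommGroup H] [InnerProductSpace ℝ H]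

theorem gelfand_apply (j : V →L[ℝ] H) (v w : V) : gelfand j v w = ⟪j v, j w⟫ := rfl

/-- The identity |a|² - |b|² = ⟨a - b, a + b⟩, arranged so that the difference sits in V*, where
increments of y are integrals of z. -/
theorem norm_sq_sub_norm_sq_eq_gelfand (j : V →L[ℝ] H) (a b : V) :
    ‖j a‖ ^ 2 - ‖j b‖ ^ 2 = (gelfand j a - gelfand j b) (a + b) := by
  simp only [_root_.sub_apply, gelfand_apply, map_add,
    real_inner_self_eq_norm_sq, real_inner_comm (j a) (j b)]
  ring

theorem L2.integrable {T : ℝ} {E : Type*} [NormedAddCommGroup E] (y : L2 T E) :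
    Integrable y (timeMeasure T) :=
  (Lp.memLp y).integrable (by norm_num)

theorem gelfand_sub_eq_integral {T : ℝ} (j : V →L[ℝ] H) (y : L2 T V)
    (z : L2 T (StrongDual ℝ V)) {ξ : StrongDual ℝ V} {s r : ℝ} (hs : s ∈ Icc 0 T) (hr : r ∈ Icc 0 T)
    (h1 : gelfand j (y s) = ξ + ∫ τ in 0..s, z τ) (h2 : gelfand j (y r) = ξ + ∫ τ in 0..r, z τ)
    (w : V) : (gelfand j (y r) - gelfand j (y s)) w = ∫ τ in s..r, z τ w := by
  have hT := hs.1.trans hs.2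
  have hz : IntervalIntegrable z volume 0 T :=
    (intervalIntegrable_iff_integrableOn_Ioc_of_le hT).2 (L2.integrable z)
  rw [← uIcc_of_le hT] at hs hr
  have h0s := hz.mono_set (uIcc_subset_uIcc left_mem_uIcc hs)
  have h0r := hz.mono_set (uIcc_subset_uIcc left_mem_uIcc hr)
  have hsr := hz.mono_set (uIcc_subset_uIcc hs hr)
  rw [h1, h2, add_sub_add_left_eq_sub, intervalIntegral.integral_interval_sub_left h0r h0s,
    ContinuousLinearMap.intervalIntegral_apply hsr]

/-- Energy identity for a.e. pair of times. -/
theorem exists_energy_identity_ae {T : ℝ} (hT : 0 < T) {j : V →L[ℝ] H} {y : L2 T V}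
    {z : L2 T (StrongDual ℝ V)} (hd : IsTimeDeriv j y z) :
    ∃ G ⊆ Ioo 0 T, (∀ᵐ t ∂(timeMeasure T), t ∈ G) ∧ ∀ s ∈ G, ∀ r ∈ G,
      (∀ w, (gelfand j (y r) - gelfand j (y s)) w = ∫ t in s..r, z t w) ∧
      ‖j (y r)‖ ^ 2 - ‖j (y s)‖ ^ 2 = 2 * ∫ t in s..r, z t (y t) := by
  obtain ⟨ξ, hξ⟩ := ae_eq_const_add_primitive hT
    ((gelfand j).integrable_comp (L2.integrable y)) (L2.integrable z) hd
  -- Extension by zero lets translations act on the whole line.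
  set y' : ℝ → V := (Ioc 0 T).indicator y with hy'
  set z' : ℝ → StrongDual ℝ V := (Ioc 0 T).indicator z with hz'
  have hym : StronglyMeasurable y' := (Lp.stronglyMeasurable y).indicator measurableSet_Ioc
  have hzm : StronglyMeasurable z' := (Lp.stronglyMeasurable z).indicator measurableSet_Ioc
  have hy2 : MemLp y' 2 volume := (memLp_indicator_iff_restrict measurableSet_Ioc).2 (Lp.memLp y)
  have hz2 : MemLp z' 2 volume := (memLp_indicator_iff_restrict measurableSet_Ioc).2 (Lp.memLp z)
  set Φ : ℝ → ℝ := fun t => ‖j (y' t)‖ ^ 2 with hΦ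
  have hΦi : Integrable Φ := (j.comp_memLp' hy2).norm.integrable_sq
  have hae : ∀ᵐ t : ℝ, t ∈ Ioc 0 T → gelfand j (y t) = ξ + ∫ τ in 0..t, z τ :=
    (ae_restrict_iff' measurableSet_Ioc).1 hξ
  -- Good times: y agrees with its primitive there, and the primitive of Φ is differentiable with
  -- the expected value.
  let G : Set ℝ := {t | t ∈ Ioo 0 T ∧ gelfand j (y t) = ξ + ∫ τ in 0..t, z τ ∧
    HasDerivAt (fun x => ∫ t in 0..x, Φ t) (Φ t) t}
  have hGae : ∀ᵐ t ∂(timeMeasure T), t ∈ G := by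
    rw [timeMeasure, ← restrict_Ioo_eq_restrict_Ioc, ae_restrict_iff' measurableSet_Ioo]
    filter_upwards [hae, LocallyIntegrable.ae_hasDerivAt_integral hΦi.locallyIntegrable] with t h1 h2 h3
    exact ⟨h3, h1 (Ioo_subset_Ioc_self h3), h2 0⟩
  have hy'e : ∀ t ∈ Ioc 0 T, y' t = y t := fun t ht => indicator_of_mem ht _
  have hz'e : ∀ t ∈ Ioc 0 T, z' t = z t := fun t ht => indicator_of_mem ht _
  have key : ∀ s ∈ G, ∀ r ∈ G, s ≤ r →
      ‖j (y r)‖ ^ 2 - ‖j (y s)‖ ^ 2 = 2 * ∫ t in s..r, z t (y t) := fun s hs r hr hsr => by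
    -- Shifts h < T - r keep t + h inside (0, T] for every t ≤ r.
    have hrT : 0 < T - r := sub_pos.2 hr.1.2
    have := sub_eq_integral_of_steklov hy2 hym hz2 hzm hΦi hsr hrT (fun h hh => ?_) hs.2.2 hr.2.2
    · simp only [hΦ, hy'e s (Ioo_subset_Ioc_self hs.1), hy'e r (Ioo_subset_Ioc_self hr.1)] at this
      rw [this]
      congr 1
      refine intervalIntegral.integral_congr fun t ht => ?_
      rw [uIcc_of_le hsr] at ht
      have htI : t ∈ Ioc 0 T := ⟨hs.1.1.trans_le ht.1, ht.2.trans hr.1.2.le⟩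
      simp only [hy'e t htI, hz'e t htI]
    · rw [ae_restrict_iff' measurableSet_Ioc]
      filter_upwards [hae,
        (measurePreserving_add_right volume h).quasiMeasurePreserving.ae hae] with t h1 h2 ht
      have htI : t ∈ Ioc 0 T := ⟨hs.1.1.trans ht.1, ht.2.trans hr.1.2.le⟩
      have hthI : t + h ∈ Ioc 0 T := ⟨by linarith [htI.1, hh.1], by linarith [ht.2, hh.2]⟩
      simp only [hΦ, hy'e t htI, hy'e _ hthI]
      rw [norm_sq_sub_norm_sq_eq_gelfand, gelfand_sub_eq_integral j y z (Ioc_subset_Icc_self htI)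
        (Ioc_subset_Icc_self hthI) (h1 htI) (h2 hthI),
        intervalIntegral.integral_comp_add_left (fun τ => z' τ (y (t + h) + y t)), add_zero]
      refine intervalIntegral.integral_congr fun τ hτ => ?_
      rw [uIcc_of_le (by linarith [hh.1])] at hτ
      rw [hz'e]
      exact ⟨by linarith [hτ.1, htI.1], hτ.2.trans hthI.2⟩
  refine ⟨G, fun t ht => ht.1, hGae, fun s hs r hr => ⟨?_, ?_⟩⟩
  · exact gelfand_sub_eq_integral j y z (Ioo_subset_Icc_self hs.1) (Ioo_subset_Icc_self hr.1)
      hs.2.1 hr.2.1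
  · rcases le_total s r with h | h
    · exact key s hs r hr h
    · rw [intervalIntegral.integral_symm, mul_neg, ← key r hr s hs h]
      ring

theorem L2.integrable_norm_sq {T : ℝ} {E : Type*} [NormedAddCommGroup E] (y : L2 T E) :
    Integrable (fun t => ‖y t‖ ^ 2) (timeMeasure T) :=
  (Lp.memLp y).norm.integrable_sq

theorem abs_intervalIntegral_le_of_subset {T : ℝ} {A : Set ℝ} {s r : ℝ} {k m : ℝ → ℝ}
    (hA : MeasurableSet A) (hsr : uIoc s r ⊆ A ∩ Ioc 0 T) (hm : Integrable m (timeMeasure T))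
    (hkm : ∀ t, |k t| ≤ m t) :
    |∫ t in s..r, k t| ≤ ∫ t in A, m t ∂(timeMeasure T) := by
  rw [timeMeasure, Measure.restrict_restrict hA]
  have hm' : IntegrableOn m (A ∩ Ioc 0 T) := IntegrableOn.mono_set (t := Ioc 0 T) hm inter_subset_right
  calc |∫ t in s..r, k t| ≤ |∫ t in s..r, m t| := by
        refine intervalIntegral.norm_integral_le_abs_of_norm_le (f := k) (g := m)
          (Eventually.of_forall fun t => hkm t) ?_
        exact intervalIntegrable_iff.2 (hm'.mono_set hsr)
    _ = ∫ t in uIoc s r, m t := by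
        rw [intervalIntegral.abs_integral_eq_abs_integral_uIoc, abs_of_nonneg]
        exact integral_nonneg fun t => (abs_nonneg _).trans (hkm t)
    _ ≤ ∫ t in A ∩ Ioc 0 T, m t :=
        setIntegral_mono_set hm' (Eventually.of_forall fun t => (abs_nonneg _).trans (hkm t))
          (LE.le.eventuallyLE hsr)

theorem timeMeasure_ball_ne_zero {T t₀ δ : ℝ} (hT : 0 < T) (ht₀ : t₀ ∈ Icc 0 T) (hδ : 0 < δ) :
    timeMeasure T (Ioo (t₀ - δ) (t₀ + δ)) ≠ 0 := by
  have hsub : Ioo (max 0 (t₀ - δ)) (min T (t₀ + δ)) ⊆ Ioo (t₀ - δ) (t₀ + δ) ∩ Ioc 0 T :=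
    fun x hx => ⟨⟨(le_max_right _ _).trans_lt hx.1, hx.2.trans_le (min_le_right _ _)⟩,
      (le_max_left _ _).trans_lt hx.1, (hx.2.trans_le (min_le_left _ _)).le⟩
  rw [timeMeasure, Measure.restrict_apply measurableSet_Ioo]
  refine (lt_of_lt_of_le ?_ (measure_mono hsub)).ne'
  rw [Real.volume_Ioo, ENNReal.ofReal_pos, sub_pos, lt_min_iff, max_lt_iff, max_lt_iff]
  exact ⟨⟨hT, by linarith [ht₀.2]⟩, by linarith [ht₀.1], by linarith⟩

/-- The reference time s is chosen with ‖y s‖² at most its mean over the interval, so that the term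
with the frozen value y s is also controlled by the L² norm of y there. The bound tends to 0 with
the length of the interval. -/
theorem norm_sub_sq_le_setIntegral {T : ℝ} {j : V →L[ℝ] H} {y : L2 T V}
    {z : L2 T (StrongDual ℝ V)} {G : Set ℝ} (hGT : G ⊆ Ioo 0 T)
    (hG : ∀ᵐ t ∂(timeMeasure T), t ∈ G) (hE : ∀ s ∈ G, ∀ r ∈ G,
      (∀ w, (gelfand j (y r) - gelfand j (y s)) w = ∫ t in s..r, z t w) ∧
      ‖j (y r)‖ ^ 2 - ‖j (y s)‖ ^ 2 = 2 * ∫ t in s..r, z t (y t))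
    {a b : ℝ} (hA : timeMeasure T (Ioo a b) ≠ 0) :
    ∃ s, ∀ r ∈ G ∩ Ioo a b, ‖j (y r) - j (y s)‖ ^ 2 ≤
      4 * ∫ t in Ioo a b, (‖z t‖ ^ 2 + ‖y t‖ ^ 2) ∂(timeMeasure T) := by
  set A := Ioo a b
  set ν := (timeMeasure T).restrict A with hν
  have hν0 : ν ≠ 0 := by rwa [hν, Ne, Measure.restrict_eq_zero]
  have hnull : ν {t | ¬ t ∈ G ∩ A} = 0 := by
    refine ae_iff.1 ?_
    filter_upwards [ae_restrict_of_ae hG, ae_restrict_mem measurableSet_Ioo] with t h1 h2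
    exact ⟨h1, h2⟩
  obtain ⟨s, hs, hsa⟩ := exists_notMem_null_le_average hν0
    (f := fun t => ‖y t‖ ^ 2) (L2.integrable_norm_sq y).restrict hnull
  rw [mem_ofPred_eq, not_not] at hs
  have hsa' : ∫ t in A, ‖y s‖ ^ 2 ∂(timeMeasure T) ≤ ∫ t in A, ‖y t‖ ^ 2 ∂(timeMeasure T) := by
    have := integral_average ν (fun t => ‖y t‖ ^ 2)
    rw [← this]
    exact integral_mono (integrable_const _) (integrable_const _) fun t => hsa
  refine ⟨s, fun r hr => ?_⟩
  have hsub : uIoc s r ⊆ A ∩ Ioc 0 T := fun t ht =>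
    ⟨ordConnected_Ioo.uIcc_subset hs.2 hr.2 (uIoc_subset_uIcc ht),
      Ioo_subset_Ioc_self (ordConnected_Ioo.uIcc_subset (hGT hs.1) (hGT hr.1)
        (uIoc_subset_uIcc ht))⟩
  have hyi := L2.integrable_norm_sq y
  have hzi := L2.integrable_norm_sq z
  have b1 := abs_intervalIntegral_le_of_subset (k := fun t => z t (y t)) measurableSet_Ioo hsub
    (hzi.add hyi) fun t => norm_apply_le_sq_add_sq _ _
  have b2 := abs_intervalIntegral_le_of_subset (k := fun t => z t (y s)) measurableSet_Ioo hsub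
    (hzi.add (integrable_const (‖y s‖ ^ 2))) fun t => norm_apply_le_sq_add_sq _ _
  -- From |a - b|² = |a|² - |b|² - 2⟨a - b, b⟩: the energy identity gives the first part, the
  -- increment formula tested with y s the second.
  have e : ‖j (y r) - j (y s)‖ ^ 2 =
      2 * (∫ t in s..r, z t (y t)) - 2 * ∫ t in s..r, z t (y s) := by
    rw [← (hE s hs.1 r hr.1).2, ← (hE s hs.1 r hr.1).1 (y s), norm_sub_sq_real,
      _root_.sub_apply, gelfand_apply, gelfand_apply, real_inner_self_eq_norm_sq]
    ring
  simp only [Pi.add_apply] at b1 b2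
  rw [integral_add hzi.restrict (integrable_const _)] at b2
  have e2 := integral_add (hzi.restrict (s := A)) (hyi.restrict (s := A))
  rw [e2] at b1 ⊢
  rw [e]
  have := (abs_le.1 b1).2
  have := (abs_le.1 b2).1
  linarith

/-- Embedding of `W(0,T;V)` into `C([0,T];H)`, with the energy identity. -/
theorem IsTimeDeriv.exists_continuousOn {T : ℝ} (hT : 0 < T) [CompleteSpace H] {j : V →L[ℝ] H}
    {y : L2 T V} {z : L2 T (StrongDual ℝ V)} (hd : IsTimeDeriv j y z) :
    ∃ g : ℝ → H, ContinuousOn g (Icc 0 T) ∧ (∀ᵐ t ∂(timeMeasure T), g t = j (y t)) ∧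
      ‖g T‖ ^ 2 - ‖g 0‖ ^ 2 = 2 * pairing z y := by
  obtain ⟨G, hGT, hG, hE⟩ := exists_energy_identity_ae hT hd
  -- A set of full measure is dense, also at the endpoints.
  have hcl : Icc 0 T ⊆ closure G := fun t₀ ht₀ => by
    rw [Metric.mem_closure_iff]
    intro δ hδ
    have h := timeMeasure_ball_ne_zero hT ht₀ hδ
    have hn : (timeMeasure T) (G ∩ Ioo (t₀ - δ) (t₀ + δ)) ≠ 0 := by
      rwa [Measure.measure_inter_eq_of_ae hG]
    obtain ⟨x, hxG, hx⟩ := nonempty_of_measure_ne_zero hn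
    refine ⟨x, hxG, ?_⟩
    rw [dist_comm, Real.dist_eq, abs_lt]
    exact ⟨by linarith [hx.1], by linarith [hx.2]⟩
  have hm := (L2.integrable_norm_sq z).add (L2.integrable_norm_sq y)
  have hlim : ∀ t₀ ∈ Icc 0 T, ∃ L, Tendsto (fun t => j (y t)) (𝓝[G] t₀) (𝓝 L) := fun t₀ ht₀ => by
    have : NeBot (𝓝[G] t₀) := mem_closure_iff_nhdsWithin_neBot.1 (hcl ht₀)
    refine cauchy_map_iff_exists_tendsto.1 (Metric.cauchy_iff.2 ⟨inferInstance, fun ε hε => ?_⟩)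
    have hmeas : Tendsto (fun δ : ℝ => timeMeasure T (Ioo (t₀ - δ) (t₀ + δ))) (𝓝[>] 0) (𝓝 0) := by
      have h1 : Tendsto (fun δ : ℝ => ENNReal.ofReal (2 * δ)) (𝓝[>] 0) (𝓝 0) := by
        have : Tendsto (fun δ : ℝ => ENNReal.ofReal (2 * δ)) (𝓝 0) (𝓝 (ENNReal.ofReal (2 * 0))) :=
          ENNReal.tendsto_ofReal ((continuous_const.mul continuous_id).tendsto 0)
        rw [mul_zero, ENNReal.ofReal_zero] at this
        exact this.mono_left nhdsWithin_le_nhds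
      refine tendsto_of_tendsto_of_tendsto_of_le_of_le tendsto_const_nhds h1
        (fun _ => zero_le) fun δ => ?_
      refine (Measure.restrict_apply_le _ _).trans ?_
      rw [Real.volume_Ioo]
      exact ENNReal.ofReal_le_ofReal (by linarith)
    have h0 := hm.tendsto_setIntegral_nhds_zero hmeas
    -- The threshold ε²/16, times the factor 4 of the local estimate, is (ε/2)²: two good times near
    -- t₀ then differ by less than ε in H.
    obtain ⟨δ, hδi, hδ⟩ := ((h0.eventually (gt_mem_nhds (show (0 : ℝ) < ε ^ 2 / 16 by positivity))).and
      self_mem_nhdsWithin).exists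
    have hδ : 0 < δ := hδ
    obtain ⟨s, hs⟩ := norm_sub_sq_le_setIntegral hGT hG hE (timeMeasure_ball_ne_zero hT ht₀ hδ)
    have hs' : ∀ r ∈ G ∩ Ioo (t₀ - δ) (t₀ + δ), ‖j (y r) - j (y s)‖ < ε / 2 := fun r hr => by
      have h1 := hs r hr
      simp only [Pi.add_apply] at hδi
      refine lt_of_pow_lt_pow_left₀ 2 (by positivity) ?_
      linarith [show (ε / 2) ^ 2 = 4 * (ε ^ 2 / 16) by ring]
    refine ⟨_, image_mem_map (inter_mem_nhdsWithin G
      (Ioo_mem_nhds (show t₀ - δ < t₀ by linarith) (show t₀ < t₀ + δ by linarith))), ?_⟩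
    rintro _ ⟨r, hr, rfl⟩ _ ⟨r', hr', rfl⟩
    have h1 := hs' r hr
    have h2 := hs' r' hr'
    have h3 := dist_triangle_right (j (y r)) (j (y r')) (j (y s))
    rw [dist_eq_norm, dist_eq_norm (j (y r)) (j (y s)), dist_eq_norm (j (y r')) (j (y s))] at h3
    rw [dist_eq_norm]
    linarith
  have hcont : ContinuousOn (extendFrom G fun t => j (y t)) (Icc 0 T) :=
    continuousOn_extendFrom hcl hlim
  have hext : ∀ t ∈ G, extendFrom G (fun t => j (y t)) t = j (y t) := fun t ht => by
    obtain ⟨L, hL⟩ := hlim t (Ioo_subset_Icc_self (hGT ht))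
    have : L = j (y t) := tendsto_nhds_unique (hL.mono_left (pure_le_nhdsWithin ht))
      (tendsto_pure_nhds _ _)
    rw [this] at hL
    exact extendFrom_eq (subset_closure ht) hL
  refine ⟨_, hcont, hG.mono hext, ?_⟩
  set g := extendFrom G fun t => j (y t)
  obtain ⟨s, hs⟩ : G.Nonempty := by
    rw [← closure_nonempty_iff]
    exact ⟨0, hcl (left_mem_Icc.2 hT.le)⟩
  have hzy : IntervalIntegrable (fun t => z t (y t)) volume 0 T :=
    (intervalIntegrable_iff_integrableOn_Ioc_of_le hT.le).2
      (integrable_dual_apply (Lp.memLp z) (Lp.memLp y))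
  have hprim : ContinuousOn (fun r => 2 * ∫ t in 0..r, z t (y t)) (Icc 0 T) := by
    have := intervalIntegral.continuousOn_primitive_interval' hzy left_mem_uIcc
    rw [uIcc_of_le hT.le] at this
    exact continuousOn_const.mul this
  -- The energy balance is constant on G, and both sides are continuous, so it holds up to the
  -- endpoints 0 and T.
  have hEq : EqOn (fun r => ‖g r‖ ^ 2 - 2 * ∫ t in 0..r, z t (y t))
      (fun _ => ‖g s‖ ^ 2 - 2 * ∫ t in 0..s, z t (y t)) (Icc 0 T) := by
    refine EqOn.of_subset_closure (s := G) (fun r hr => ?_) ((hcont.norm.pow 2).sub hprim)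
      continuousOn_const (hGT.trans Ioo_subset_Icc_self) hcl
    have h1 := (hE s hs r hr).2
    have hmem : ∀ x ∈ G, x ∈ uIcc 0 T := fun x hx => by
      rw [uIcc_of_le hT.le]
      exact Ioo_subset_Icc_self (hGT hx)
    have h2 := intervalIntegral.integral_add_adjacent_intervals
      (hzy.mono_set (uIcc_subset_uIcc left_mem_uIcc (hmem s hs)))
      (hzy.mono_set (uIcc_subset_uIcc (hmem s hs) (hmem r hr)))
    simp only [hext r hr, hext s hs, g]
    linarith
  have e0 := hEq (left_mem_Icc.2 hT.le)
  have eT := hEq (right_mem_Icc.2 hT.le)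
  simp only [intervalIntegral.integral_same] at e0 eT
  rw [intervalIntegral.integral_of_le hT.le] at eT
  change _ - 2 * pairing z y = _ at eT
  linarith

end Embedding

end InitialControl

namespace InitialControl

/-! ### Linearity, traces and integration by parts -/

section Algebra

variable {V H : Type*}
  [NormedAddCommGroup V] [InnerProductSpace ℝ V]
  [NormedAddCommGroup H] [InnerProductSpace ℝ H]

/-- The duality pairing as a continuous bilinear map. -/
noncomputable def pairingL (T : ℝ) (V : Type*) [NormedAddCommGroup V] [InnerProductSpace ℝ V] :
    L2 T (StrongDual ℝ V) →L[ℝ] L2 T V →L[ℝ] ℝ :=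
  (ContinuousLinearMap.id ℝ (StrongDual ℝ V)).lpPairing (timeMeasure T) 2 2

theorem pairingL_apply {T : ℝ} (z : L2 T (StrongDual ℝ V)) (φ : L2 T V) :
    pairingL T V z φ = pairing z φ :=
  ContinuousLinearMap.lpPairing_eq_integral _ _ _

theorem integrable_smul_of_hasCompactSupport {T : ℝ} {E : Type*} [NormedAddCommGroup E] [NormedSpace ℝ E]
    {θ : ℝ → ℝ} (hθ : Continuous θ) (hc : HasCompactSupport θ) {u : ℝ → E}
    (hu : Integrable u (timeMeasure T)) : Integrable (fun t => θ t • u t) (timeMeasure T) := by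
  obtain ⟨C, hC⟩ := hc.exists_bound_of_continuous hθ
  exact hu.bdd_smul C hθ.aestronglyMeasurable (Filter.Eventually.of_forall hC)

theorem IsTimeDeriv.add {T : ℝ} {j : V →L[ℝ] H} {y₁ y₂ : L2 T V} {z₁ z₂ : L2 T (StrongDual ℝ V)}
    (h₁ : IsTimeDeriv j y₁ z₁) (h₂ : IsTimeDeriv j y₂ z₂) :
    IsTimeDeriv j (y₁ + y₂) (z₁ + z₂) := fun θ hθ hc hs => by
  have hθ' : Continuous (deriv θ) := hθ.continuous_deriv (by simp)
  have e1 : ∫ t, deriv θ t • gelfand j ((y₁ + y₂ : L2 T V) t) ∂(timeMeasure T) =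
      ∫ t, (deriv θ t • gelfand j (y₁ t) + deriv θ t • gelfand j (y₂ t)) ∂(timeMeasure T) := by
    refine integral_congr_ae ?_
    filter_upwards [Lp.coeFn_add y₁ y₂] with t ht
    rw [ht, Pi.add_apply, map_add, smul_add]
  have e2 : ∫ t, θ t • (z₁ + z₂ : L2 T (StrongDual ℝ V)) t ∂(timeMeasure T) =
      ∫ t, (θ t • z₁ t + θ t • z₂ t) ∂(timeMeasure T) := by
    refine integral_congr_ae ?_
    filter_upwards [Lp.coeFn_add z₁ z₂] with t ht
    rw [ht, Pi.add_apply, smul_add]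
  rw [e1, e2, integral_add, integral_add, h₁ θ hθ hc hs, h₂ θ hθ hc hs, neg_add]
  · exact integrable_smul_of_hasCompactSupport hθ.continuous hc (L2.integrable z₁)
  · exact integrable_smul_of_hasCompactSupport hθ.continuous hc (L2.integrable z₂)
  · exact integrable_smul_of_hasCompactSupport hθ' hc.deriv ((gelfand j).integrable_comp (L2.integrable y₁))
  · exact integrable_smul_of_hasCompactSupport hθ' hc.deriv ((gelfand j).integrable_comp (L2.integrable y₂))

theorem IsTimeDeriv.const_smul {T : ℝ} {j : V →L[ℝ] H} {y : L2 T V} {z : L2 T (StrongDual ℝ V)}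
    (h : IsTimeDeriv j y z) (c : ℝ) : IsTimeDeriv j (c • y) (c • z) := fun θ hθ hc hs => by
  have e1 : ∫ t, deriv θ t • gelfand j ((c • y : L2 T V) t) ∂(timeMeasure T) =
      ∫ t, c • deriv θ t • gelfand j (y t) ∂(timeMeasure T) := by
    refine integral_congr_ae ?_
    filter_upwards [Lp.coeFn_smul c y] with t ht
    rw [ht, Pi.smul_apply, map_smul, smul_comm]
  have e2 : ∫ t, θ t • (c • z : L2 T (StrongDual ℝ V)) t ∂(timeMeasure T) =
      ∫ t, c • θ t • z t ∂(timeMeasure T) := by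
    refine integral_congr_ae ?_
    filter_upwards [Lp.coeFn_smul c z] with t ht
    rw [ht, Pi.smul_apply, smul_comm]
  rw [e1, e2, integral_smul, integral_smul, h θ hθ hc hs, smul_neg]

theorem HasTrace.add {T : ℝ} {j : V →L[ℝ] H} {y₁ y₂ : L2 T V} {s : ℝ} {h₁ h₂ : H}
    (t₁ : HasTrace j y₁ s h₁) (t₂ : HasTrace j y₂ s h₂) : HasTrace j (y₁ + y₂) s (h₁ + h₂) := by
  obtain ⟨g₁, c₁, a₁, e₁⟩ := t₁
  obtain ⟨g₂, c₂, a₂, e₂⟩ := t₂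
  refine ⟨fun t => g₁ t + g₂ t, c₁.add c₂, ?_, by simp only [e₁, e₂]⟩
  filter_upwards [a₁, a₂, Lp.coeFn_add y₁ y₂] with t b₁ b₂ b₃
  rw [b₁, b₂, b₃, Pi.add_apply, map_add]

theorem HasTrace.const_smul {T : ℝ} {j : V →L[ℝ] H} {y : L2 T V} {s : ℝ} {h : H}
    (t : HasTrace j y s h) (c : ℝ) : HasTrace j (c • y) s (c • h) := by
  obtain ⟨g, hc, ha, he⟩ := t
  refine ⟨fun t => c • g t, hc.const_smul c, ?_, by simp only [he]⟩
  filter_upwards [ha, Lp.coeFn_smul c y] with t b₁ b₂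
  rw [b₁, b₂, Pi.smul_apply, map_smul]

theorem HasTrace.unique {T : ℝ} (hT : 0 < T) {j : V →L[ℝ] H} {y : L2 T V} {s : ℝ}
    (hs : s ∈ Icc 0 T) {h₁ h₂ : H} (t₁ : HasTrace j y s h₁) (t₂ : HasTrace j y s h₂) : h₁ = h₂ := by
  obtain ⟨g₁, c₁, a₁, rfl⟩ := t₁
  obtain ⟨g₂, c₂, a₂, rfl⟩ := t₂
  refine Measure.eqOn_Icc_of_ae_eq volume hT.ne ?_ c₁ c₂ hs
  rw [← restrict_Ioc_eq_restrict_Icc]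
  filter_upwards [a₁, a₂] with t b₁ b₂
  rw [b₁, b₂]

variable [CompleteSpace H]

theorem IsTimeDeriv.exists_hasTrace {T : ℝ} (hT : 0 < T) {j : V →L[ℝ] H} {y : L2 T V}
    {z : L2 T (StrongDual ℝ V)} (hd : IsTimeDeriv j y z) (s : ℝ) : ∃ h, HasTrace j y s h := by
  obtain ⟨g, h1, h2, -⟩ := hd.exists_continuousOn hT
  exact ⟨g s, g, h1, h2, rfl⟩

theorem IsTimeDeriv.energy {T : ℝ} (hT : 0 < T) {j : V →L[ℝ] H} {y : L2 T V}
    {z : L2 T (StrongDual ℝ V)} (hd : IsTimeDeriv j y z) {h₀ h₁ : H} (t₀ : HasTrace j y 0 h₀)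
    (t₁ : HasTrace j y T h₁) : ‖h₁‖ ^ 2 - ‖h₀‖ ^ 2 = 2 * pairing z y := by
  obtain ⟨g, h1, h2, h3⟩ := hd.exists_continuousOn hT
  rw [t₀.unique hT (left_mem_Icc.2 hT.le) ⟨g, h1, h2, rfl⟩,
    t₁.unique hT (right_mem_Icc.2 hT.le) ⟨g, h1, h2, rfl⟩, h3]

/-- Integration by parts in `W(0,T;V)`. -/
theorem IsTimeDeriv.integration_by_parts {T : ℝ} (hT : 0 < T) {j : V →L[ℝ] H} {y p : L2 T V}
    {y' p' : L2 T (StrongDual ℝ V)} (hy : IsTimeDeriv j y y') (hp : IsTimeDeriv j p p')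
    {y₀ y₁ p₀ p₁ : H} (ty₀ : HasTrace j y 0 y₀) (ty₁ : HasTrace j y T y₁)
    (tp₀ : HasTrace j p 0 p₀) (tp₁ : HasTrace j p T p₁) :
    ⟪y₁, p₁⟫ - ⟪y₀, p₀⟫ = pairing y' p + pairing p' y := by
  -- Polarisation: compare the energy identities of y, p and y + p.
  have e1 := hy.energy hT ty₀ ty₁
  have e2 := hp.energy hT tp₀ tp₁
  have e3 := (hy.add hp).energy hT (ty₀.add tp₀) (ty₁.add tp₁)
  rw [norm_add_sq_real, norm_add_sq_real] at e3
  simp only [← pairingL_apply, map_add, _root_.add_apply] at *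
  linarith

end Algebra

/-! ### Duality of L²(0,T;V) and operators from measurable forms -/

section Duality

variable {V : Type*} [NormedAddCommGroup V] [InnerProductSpace ℝ V] [CompleteSpace V]

/-- Riesz in L²(0,T;V), followed by the Riesz map of V at each time. -/
theorem exists_pairing_eq {T : ℝ} (ℓ : L2 T V →L[ℝ] ℝ) :
    ∃ F : L2 T (StrongDual ℝ V), ∀ φ, pairing F φ = ℓ φ := by
  let r : L2 T V := (InnerProductSpace.toDual ℝ (L2 T V)).symm ℓ
  let D : V →L[ℝ] StrongDual ℝ V := innerSL ℝ
  refine ⟨D.compLp r, fun φ => ?_⟩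
  have h1 : ⟪r, φ⟫ = ℓ φ := InnerProductSpace.toDual_symm_apply
  rw [← h1, L2.inner_def]
  refine integral_congr_ae ?_
  filter_upwards [D.coeFn_compLp r] with t ht
  rw [ht]
  rfl

/-- Testing with the pointwise Riesz representative of z gives the integral of ‖z t‖². -/
theorem eq_zero_of_pairing_eq_zero {T : ℝ} {z : L2 T (StrongDual ℝ V)}
    (h : ∀ φ, pairing z φ = 0) : z = 0 := by
  let R : StrongDual ℝ V →L[ℝ] V :=
    { toFun := (InnerProductSpace.toDual ℝ V).symm
      map_add' := map_add _
      map_smul' := fun c x => by simp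
      cont := (InnerProductSpace.toDual ℝ V).symm.continuous }
  have h1 : ∫ t, ‖z t‖ ^ 2 ∂(timeMeasure T) = 0 := by
    rw [← h (R.compLp z)]
    refine integral_congr_ae ?_
    filter_upwards [R.coeFn_compLp z] with t ht
    rw [ht]
    have : ⟪R (z t), R (z t)⟫ = z t (R (z t)) := InnerProductSpace.toDual_symm_apply
    rw [← this, real_inner_self_eq_norm_sq]
    congr 1
    exact ((InnerProductSpace.toDual ℝ V).symm.norm_map (z t)).symm
  rw [integral_eq_zero_iff_of_nonneg (fun t => by positivity) (L2.integrable_norm_sq z)] at h1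
  rw [Lp.eq_zero_iff_ae_eq_zero]
  filter_upwards [h1] with t ht
  simpa using ht

theorem eq_of_pairing_eq {T : ℝ} {z₁ z₂ : L2 T (StrongDual ℝ V)}
    (h : ∀ φ, pairing z₁ φ = pairing z₂ φ) : z₁ = z₂ := by
  refine sub_eq_zero.1 (eq_zero_of_pairing_eq_zero fun φ => ?_)
  have := h φ
  simp only [← pairingL_apply, map_sub, _root_.sub_apply] at *
  linarith

variable [TopologicalSpace.SeparableSpace V]

/-- Weakly measurable functions with values in a separable Hilbert space are strongly
measurable. -/
theorem aestronglyMeasurable_of_inner {X : Type*} [MeasurableSpace X] {μ : Measure X} {u : X → V}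
    (h : ∀ w, AEMeasurable (fun t => ⟪w, u t⟫) μ) : AEStronglyMeasurable u μ := by
  obtain ⟨w, b, hb⟩ := exists_hilbertBasis ℝ V
  have hw : Countable w := by
    have : SecondCountableTopology V := UniformSpace.secondCountable_of_separable V
    have ho : Orthonormal ℝ ((↑) : w → V) := hb ▸ b.orthonormal
    -- Distinct orthonormal vectors are at distance √2 ≥ 1, so an orthonormal basis of a separable
    -- space is countable.
    have : DiscreteTopology w := DiscreteTopology.of_forall_le_dist one_pos fun x y hxy => by
      change (1 : ℝ) ≤ dist x y
      rw [Subtype.dist_eq, dist_eq_norm]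
      have h2 := norm_sub_sq_real (x : V) y
      rw [ho.1 x, ho.1 y, ho.2 hxy] at h2
      nlinarith [norm_nonneg ((x : V) - y)]
    exact TopologicalSpace.separableSpace_iff_countable.1 inferInstance
  have hs : ∀ t, HasSum (fun i => b.repr (u t) i • b i) (u t) := fun t => b.hasSum_repr (u t)
  refine aestronglyMeasurable_of_tendsto_ae Filter.atTop
    (f := fun (s : Finset w) t => ∑ i ∈ s, b.repr (u t) i • b i) (fun s => ?_)
    (Filter.Eventually.of_forall fun t => hs t)
  refine Finset.aestronglyMeasurable_fun_sum s fun i _ => ?_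
  simp only [b.repr_apply_apply]
  exact (h (b i)).aestronglyMeasurable.smul_const _

theorem aestronglyMeasurable_of_apply {X : Type*} [MeasurableSpace X] {μ : Measure X}
    {u : X → StrongDual ℝ V} (h : ∀ w, AEMeasurable (fun t => u t w) μ) :
    AEStronglyMeasurable u μ := by
  have h1 : AEStronglyMeasurable (fun t => (InnerProductSpace.toDual ℝ V).symm (u t)) μ := by
    refine aestronglyMeasurable_of_inner fun w => ?_
    simp only [real_inner_comm _ w, InnerProductSpace.toDual_symm_apply]
    exact h w
  have := (InnerProductSpace.toDual ℝ V).continuous.comp_aestronglyMeasurable h1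
  simpa using this

/-- A bounded weakly measurable family of bilinear forms acts from `L²(0,T;V)` to its dual. -/
theorem exists_operator {T : ℝ} {b : ℝ → V →L[ℝ] StrongDual ℝ V} {c : ℝ}
    (hb : ∀ t ∈ Ioc 0 T, ∀ φ ψ : V, |b t φ ψ| ≤ c * ‖φ‖ * ‖ψ‖)
    (hm : ∀ φ ψ : V, AEMeasurable (fun t => b t φ ψ) (timeMeasure T)) :
    ∃ B : L2 T V →L[ℝ] L2 T (StrongDual ℝ V), ∀ y, ∀ᵐ t ∂(timeMeasure T), B y t = b t (y t) := by
  have hmeas : ∀ y : L2 T V, AEStronglyMeasurable (fun t => b t (y t)) (timeMeasure T) := fun y => by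
    refine aestronglyMeasurable_of_apply fun ψ => ?_
    -- With ψ fixed, the flipped form is a V*-valued strongly measurable function and may be applied
    -- to the measurable y.
    have h1 : AEStronglyMeasurable (fun t => (b t).flip ψ) (timeMeasure T) :=
      aestronglyMeasurable_of_apply fun φ => hm φ ψ
    have h2 := isBoundedBilinearMap_apply.continuous.comp_aestronglyMeasurable
      (h1.prodMk (Lp.aestronglyMeasurable y))
    exact h2.aemeasurable
  have hbd : ∀ y : L2 T V, ∀ᵐ t ∂(timeMeasure T), ‖b t (y t)‖ ≤ |c| * ‖y t‖ := fun y => by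
    filter_upwards [ae_restrict_mem measurableSet_Ioc] with t ht
    refine ContinuousLinearMap.opNorm_le_bound _ (by positivity) fun ψ => ?_
    refine (hb t ht _ _).trans ?_
    gcongr
    exact le_abs_self c
  have hL : ∀ y : L2 T V, MemLp (fun t => b t (y t)) 2 (timeMeasure T) := fun y =>
    (Lp.memLp y).of_le_mul (hmeas y) (hbd y)
  let B₀ : L2 T V →ₗ[ℝ] L2 T (StrongDual ℝ V) :=
    { toFun := fun y => (hL y).toLp _
      map_add' := fun y₁ y₂ => by
        rw [← MemLp.toLp_add, MemLp.toLp_eq_toLp_iff]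
        filter_upwards [Lp.coeFn_add y₁ y₂] with t ht
        rw [ht, Pi.add_apply, Pi.add_apply, map_add]
      map_smul' := fun k y => by
        rw [RingHom.id_apply, ← MemLp.toLp_const_smul, MemLp.toLp_eq_toLp_iff]
        filter_upwards [Lp.coeFn_smul k y] with t ht
        rw [ht, Pi.smul_apply, Pi.smul_apply, map_smul] }
  have hco : ∀ y, ∀ᵐ t ∂(timeMeasure T), B₀ y t = b t (y t) := fun y => (hL y).coeFn_toLp
  refine ⟨B₀.mkContinuous |c| fun y => ?_, hco⟩
  refine Lp.norm_le_mul_norm_of_ae_le_mul ?_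
  filter_upwards [hco y, hbd y] with t h1 h2
  rwa [h1]

theorem L2.norm_sq_eq {T : ℝ} {E : Type*} [NormedAddCommGroup E] [InnerProductSpace ℝ E]
    (y : L2 T E) : ‖y‖ ^ 2 = ∫ t, ‖y t‖ ^ 2 ∂(timeMeasure T) := by
  rw [← real_inner_self_eq_norm_sq, L2.inner_def]
  simp only [real_inner_self_eq_norm_sq]

end Duality

end InitialControl

/-- **Lions' projection theorem**: a linear problem `K φ x = L φ` in a Hilbert space is solvable
as soon as `L` is bounded by `K` on the space of test elements. -/
theorem exists_forall_apply_eq_of_le {X M : Type*} [NormedAddCommGroup X] [InnerProductSpace ℝ X]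
    [CompleteSpace X] [AddCommGroup M] [Module ℝ M] (K : M →ₗ[ℝ] StrongDual ℝ X) (L : M →ₗ[ℝ] ℝ)
    (c : ℝ) (h : ∀ φ, |L φ| ≤ c * ‖K φ‖) : ∃ x : X, ∀ φ, K φ x = L φ := by
  -- The bound makes L vanish on the kernel of K, so L factors as ℓ ∘ K with ℓ bounded on the range.
  -- Hahn-Banach extends ℓ, and reflexivity, through Riesz, yields x.
  have hker : L ∈ K.ker.dualAnnihilator := by
    rw [Submodule.mem_dualAnnihilator]
    intro φ hφ
    have := h φ
    rw [LinearMap.mem_ker.1 hφ, norm_zero, mul_zero] at this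
    exact abs_nonpos_iff.1 this
  rw [← LinearMap.range_dualMap_eq_dualAnnihilator_ker] at hker
  obtain ⟨ℓ, rfl⟩ := hker
  let ℓ₀ : K.range →ₗ[ℝ] ℝ := LinearMap.domRestrict ℓ K.range
  let ℓ' : StrongDual ℝ K.range := LinearMap.mkContinuous ℓ₀ c fun x : K.range => by
    obtain ⟨φ, hφ⟩ := x.2
    change |ℓ x.1| ≤ c * ‖x.1‖
    rw [← hφ]
    exact h φ
  obtain ⟨g, hg, -⟩ := exists_extension_norm_eq K.range ℓ'
  let D := InnerProductSpace.toDual ℝ X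
  let gD : StrongDual ℝ X :=
    { toFun := fun y => g (D y)
      map_add' := fun y₁ y₂ => by rw [map_add, map_add]
      map_smul' := fun k y => by simp
      cont := g.continuous.comp D.continuous }
  refine ⟨D.symm gD, fun φ => ?_⟩
  have h1 : ⟪D.symm gD, D.symm (K φ)⟫ = g (D (D.symm (K φ))) :=
    InnerProductSpace.toDual_symm_apply
  have h2 : ⟪D.symm (K φ), D.symm gD⟫ = K φ (D.symm gD) := InnerProductSpace.toDual_symm_apply
  rw [← h2, real_inner_comm, h1, LinearIsometryEquiv.apply_symm_apply]
  exact hg ⟨K φ, φ, rfl⟩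

namespace InitialControl

/-! ### Existence for the forward and backward evolution equations -/

section Evolution

variable {V H : Type*}
  [NormedAddCommGroup V] [InnerProductSpace ℝ V]
  [NormedAddCommGroup H] [InnerProductSpace ℝ H]

theorem memLp_of_continuous {T : ℝ} {E : Type*} [NormedAddCommGroup E] {f : ℝ → E}
    (hf : Continuous f) : MemLp f 2 (timeMeasure T) := by
  obtain ⟨C, hC⟩ := (isCompact_Icc (a := (0 : ℝ)) (b := T)).exists_bound_of_continuousOn
    hf.continuousOn
  refine MemLp.of_bound hf.aestronglyMeasurable C ?_
  filter_upwards [ae_restrict_mem measurableSet_Ioc] with t ht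
  exact hC t (Ioc_subset_Icc_self ht)

/-- The class in `L²(0,T;E)` of a continuous function. -/
noncomputable def ofContinuous (T : ℝ) {E : Type*} [NormedAddCommGroup E] {f : ℝ → E}
    (hf : Continuous f) : L2 T E :=
  (memLp_of_continuous hf).toLp f

theorem coeFn_ofContinuous {T : ℝ} {E : Type*} [NormedAddCommGroup E] {f : ℝ → E}
    (hf : Continuous f) : ∀ᵐ t ∂(timeMeasure T), ofContinuous T hf t = f t :=
  (memLp_of_continuous hf).coeFn_toLp

theorem hasTrace_ofContinuous {T : ℝ} (j : V →L[ℝ] H) {φ : ℝ → V} (hφ : Continuous φ) (s : ℝ) :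
    HasTrace j (ofContinuous T hφ) s (j (φ s)) := by
  refine ⟨fun t => j (φ t), (j.continuous.comp hφ).continuousOn, ?_, rfl⟩
  filter_upwards [coeFn_ofContinuous (T := T) hφ] with t ht
  rw [ht]

/-- The classical derivative of a `C¹` function, as an element of `L²(0,T;V*)`. -/
noncomputable def derivClass (T : ℝ) (j : V →L[ℝ] H) {φ : ℝ → V} (hφ : ContDiff ℝ 1 φ) :
    L2 T (StrongDual ℝ V) :=
  ofContinuous T ((gelfand j).continuous.comp (hφ.continuous_deriv le_rfl))

theorem isTimeDeriv_derivClass {T : ℝ} (hT : 0 < T) (j : V →L[ℝ] H) {φ : ℝ → V}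
    (hφ : ContDiff ℝ 1 φ) : IsTimeDeriv j (ofContinuous T hφ.continuous) (derivClass T j hφ) := by
  intro θ hθ hc hs
  have hθ0 : ∀ x, x ∉ Ioo 0 T → θ x = 0 := fun x hx => by
    by_contra hne
    exact hx (hs (subset_tsupport θ hne))
  have hθ' : Continuous (deriv θ) := hθ.continuous_deriv (by simp)
  have hφ' : Continuous (deriv φ) := hφ.continuous_deriv le_rfl
  have e1 : ∫ t, deriv θ t • gelfand j (ofContinuous T hφ.continuous t) ∂(timeMeasure T) =
      ∫ t in 0..T, deriv θ t • gelfand j (φ t) := by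
    rw [intervalIntegral.integral_of_le hT.le]
    refine integral_congr_ae ?_
    filter_upwards [coeFn_ofContinuous (T := T) hφ.continuous] with t ht
    rw [ht]
  have e2 : ∫ t, θ t • derivClass T j hφ t ∂(timeMeasure T) =
      ∫ t in 0..T, θ t • gelfand j (deriv φ t) := by
    rw [intervalIntegral.integral_of_le hT.le]
    refine integral_congr_ae ?_
    filter_upwards [coeFn_ofContinuous (T := T)
      ((gelfand j).continuous.comp (hφ.continuous_deriv le_rfl))] with t ht
    rw [derivClass, ht]
    rfl
  have hd : ∀ t ∈ uIcc 0 T, HasDerivAt (fun t => θ t • gelfand j (φ t))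
      (θ t • gelfand j (deriv φ t) + deriv θ t • gelfand j (φ t)) t := fun t _ =>
    ((hθ.differentiable (by simp)) t).hasDerivAt.smul
      ((gelfand j).hasFDerivAt.comp_hasDerivAt t ((hφ.differentiable (by simp)) t).hasDerivAt)
  have i1 : IntervalIntegrable (fun t => θ t • gelfand j (deriv φ t)) volume 0 T :=
    (hθ.continuous.smul ((gelfand j).continuous.comp hφ')).intervalIntegrable _ _
  have i2 : IntervalIntegrable (fun t => deriv θ t • gelfand j (φ t)) volume 0 T :=
    (hθ'.smul ((gelfand j).continuous.comp hφ.continuous)).intervalIntegrable _ _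
  have := intervalIntegral.integral_eq_sub_of_hasDerivAt hd (i1.add i2)
  rw [intervalIntegral.integral_add i1 i2, hθ0 T (fun h => lt_irrefl _ h.2),
    hθ0 0 (fun h => lt_irrefl _ h.1), zero_smul, zero_smul, sub_zero] at this
  rw [e1, e2]
  exact eq_neg_of_add_eq_zero_right this

/-- `C¹` test functions vanishing at the time `e`. -/
def testSpace (V : Type*) [NormedAddCommGroup V] [InnerProductSpace ℝ V] (e : ℝ) :
    Submodule ℝ (ℝ → V) where
  carrier := {φ | ContDiff ℝ 1 φ ∧ φ e = 0}
  add_mem' := fun h₁ h₂ => ⟨h₁.1.add h₂.1, by rw [Pi.add_apply, h₁.2, h₂.2, add_zero]⟩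
  zero_mem' := ⟨contDiff_const, rfl⟩
  smul_mem' := fun c _ h => ⟨h.1.const_smul c, by rw [Pi.smul_apply, h.2, smul_zero]⟩

/-- Test functions as elements of `L²(0,T;V)`. -/
noncomputable def testToL2 (T e : ℝ) : testSpace V e →ₗ[ℝ] L2 T V where
  toFun φ := ofContinuous T φ.2.1.continuous
  map_add' _ _ := MemLp.toLp_add _ _
  map_smul' c _ := MemLp.toLp_const_smul c _

/-- The classical derivative of test functions. -/
noncomputable def testDeriv (T e : ℝ) (j : V →L[ℝ] H) :
    testSpace V e →ₗ[ℝ] L2 T (StrongDual ℝ V) where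
  toFun φ := derivClass T j φ.2.1
  map_add' φ ψ := by
    rw [derivClass, derivClass, derivClass, ofContinuous, ofContinuous, ofContinuous,
      ← MemLp.toLp_add, MemLp.toLp_eq_toLp_iff]
    refine Filter.Eventually.of_forall fun t => ?_
    change gelfand j (deriv ((φ : ℝ → V) + (ψ : ℝ → V)) t) = _
    rw [deriv_add ((φ.2.1.differentiable (by simp)) t) ((ψ.2.1.differentiable (by simp)) t),
      map_add]
    rfl
  map_smul' c φ := by
    rw [derivClass, derivClass, ofContinuous, ofContinuous, RingHom.id_apply,
      ← MemLp.toLp_const_smul, MemLp.toLp_eq_toLp_iff]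
    refine Filter.Eventually.of_forall fun t => ?_
    change gelfand j (deriv (c • (φ : ℝ → V)) t) = _
    rw [deriv_const_smul _ ((φ.2.1.differentiable (by simp)) t), map_smul]
    rfl

/-- Forward (`σ = 1`) and backward (`σ = -1`) orientation of the time interval, with initial
time `e₀` and final time `e₁`. -/
def IsOrientation (T σ e₀ e₁ : ℝ) : Prop :=
  (σ = 1 ∧ e₀ = 0 ∧ e₁ = T) ∨ (σ = -1 ∧ e₀ = T ∧ e₁ = 0)

theorem IsOrientation.mul_self {T σ e₀ e₁ : ℝ} (h : IsOrientation T σ e₀ e₁) : σ * σ = 1 := by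
  rcases h with ⟨rfl, -, -⟩ | ⟨rfl, -, -⟩ <;> norm_num

theorem IsOrientation.ne {T σ e₀ e₁ : ℝ} (hT : 0 < T) (h : IsOrientation T σ e₀ e₁) :
    e₀ - e₁ ≠ 0 := by
  rcases h with ⟨-, rfl, rfl⟩ | ⟨-, rfl, rfl⟩
  · linarith
  · linarith

variable [CompleteSpace H]

theorem IsOrientation.integration_by_parts {T σ e₀ e₁ : ℝ} (hT : 0 < T)
    (h : IsOrientation T σ e₀ e₁) {j : V →L[ℝ] H} {y p : L2 T V}
    {y' p' : L2 T (StrongDual ℝ V)} (hy : IsTimeDeriv j y y') (hp : IsTimeDeriv j p p')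
    {y₀ y₁ p₀ p₁ : H} (ty₀ : HasTrace j y e₀ y₀) (ty₁ : HasTrace j y e₁ y₁)
    (tp₀ : HasTrace j p e₀ p₀) (tp₁ : HasTrace j p e₁ p₁) :
    ⟪y₁, p₁⟫ - ⟪y₀, p₀⟫ = σ * (pairing y' p + pairing p' y) := by
  rcases h with ⟨rfl, rfl, rfl⟩ | ⟨rfl, rfl, rfl⟩
  · rw [hy.integration_by_parts hT hp ty₀ ty₁ tp₀ tp₁, one_mul]
  · rw [← hy.integration_by_parts hT hp ty₁ ty₀ tp₁ tp₀]
    ring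

/-- A priori estimate for the homogeneous evolution equation `σ y' + B y = 0`. -/
theorem norm_sq_le_of_homogeneous {T σ e₀ e₁ γ : ℝ} (hT : 0 < T) (ho : IsOrientation T σ e₀ e₁)
    {j : V →L[ℝ] H} {B : L2 T V →L[ℝ] L2 T (StrongDual ℝ V)}
    (hB : ∀ y, γ * ‖y‖ ^ 2 ≤ pairing (B y) y) {y : L2 T V} {z : L2 T (StrongDual ℝ V)}
    (hd : IsTimeDeriv j y z) (he : σ • z + B y = 0) {v : H} (ht : HasTrace j y e₀ v) :
    2 * γ * ‖y‖ ^ 2 ≤ ‖v‖ ^ 2 := by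
  obtain ⟨h₁, ht₁⟩ := hd.exists_hasTrace hT e₁
  have h := ho.integration_by_parts hT hd hd ht ht₁ ht ht₁
  rw [real_inner_self_eq_norm_sq, real_inner_self_eq_norm_sq] at h
  have h2 : σ * pairing z y + pairing (B y) y = 0 := by
    have := congrArg (fun w => pairingL T V w y) he
    simpa only [map_add, map_smul, _root_.add_apply, _root_.smul_apply, map_zero,
      _root_.zero_apply, pairingL_apply, smul_eq_mul] using this
  nlinarith [hB y, sq_nonneg ‖h₁‖]

variable [CompleteSpace V]

/-- The derivative is moved onto C¹ test functions vanishing at e₁, which encodes the datum at e₀ as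
a boundary term. Lions' theorem applies since the form is coercive on test functions, in the L² norm
together with the value at e₀. -/
theorem exists_weak_solution {T σ e₀ e₁ γ : ℝ} (hT : 0 < T) (ho : IsOrientation T σ e₀ e₁)
    (hγ : 0 < γ) (j : V →L[ℝ] H) {B : L2 T V →L[ℝ] L2 T (StrongDual ℝ V)}
    (hB : ∀ y, γ * ‖y‖ ^ 2 ≤ pairing (B y) y) (F : L2 T (StrongDual ℝ V)) (v : H) :
    ∃ y : L2 T V, ∀ φ : testSpace V e₁,
      -σ * pairing (testDeriv T e₁ j φ) y + pairing (B y) (testToL2 T e₁ φ) =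
        pairing F (testToL2 T e₁ φ) + ⟪v, j ((φ : ℝ → V) e₀)⟫ := by
  let ι := testToL2 (V := V) T e₁
  let P := pairingL T V
  let K : testSpace V e₁ →ₗ[ℝ] StrongDual ℝ (L2 T V) :=
    (-σ) • (P.toLinearMap ∘ₗ testDeriv T e₁ j) + ((P ∘L B).flip).toLinearMap ∘ₗ ι
  let ev : testSpace V e₁ →ₗ[ℝ] ℝ :=
    { toFun := fun φ => ⟪v, j ((φ : ℝ → V) e₀)⟫
      map_add' := fun φ ψ => by simp [inner_add_right]
      map_smul' := fun c φ => by simp [inner_smul_right] }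
  let L : testSpace V e₁ →ₗ[ℝ] ℝ := (P F).toLinearMap ∘ₗ ι + ev
  have hK : ∀ φ x, K φ x = -σ * pairing (testDeriv T e₁ j φ) x + pairing (B x) (ι φ) := by
    intro φ x
    rw [← pairingL_apply, ← pairingL_apply]
    rfl
  have hL : ∀ φ, L φ = pairing F (ι φ) + ⟪v, j ((φ : ℝ → V) e₀)⟫ := fun φ => by
    rw [← pairingL_apply]
    rfl
  have hcoer : ∀ φ : testSpace V e₁,
      1 / 2 * ‖j ((φ : ℝ → V) e₀)‖ ^ 2 + γ * ‖ι φ‖ ^ 2 ≤ K φ (ι φ) := fun φ => by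
    have hd := isTimeDeriv_derivClass hT j φ.2.1
    have t0 := hasTrace_ofContinuous (T := T) j φ.2.1.continuous e₀
    have t1 := hasTrace_ofContinuous (T := T) j φ.2.1.continuous e₁
    have h := ho.integration_by_parts hT hd hd t0 t1 t0 t1
    change _ = σ * (pairing (testDeriv T e₁ j φ) (ι φ) + pairing (testDeriv T e₁ j φ) (ι φ)) at h
    rw [φ.2.2, map_zero, inner_zero_left, real_inner_self_eq_norm_sq] at h
    have h2 := hB (ι φ)
    rw [hK]
    linarith
  set m : ℝ := min γ (1 / 2) with hm
  have hm0 : 0 < m := lt_min hγ (by norm_num)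
  obtain ⟨y, hy⟩ := exists_forall_apply_eq_of_le K L ((‖P F‖ + ‖v‖) / m) fun φ => by
    set a := ‖ι φ‖
    set b := ‖j ((φ : ℝ → V) e₀)‖
    have ha : 0 ≤ a := norm_nonneg _
    have hb : 0 ≤ b := norm_nonneg _
    have h1 : m * (a ^ 2 + b ^ 2) ≤ ‖K φ‖ * a := by
      have h3 := (hcoer φ).trans ((le_abs_self _).trans ((K φ).le_opNorm (ι φ)))
      have h4 := mul_le_mul_of_nonneg_right (min_le_left γ (1 / 2)) (sq_nonneg a)
      have h5 := mul_le_mul_of_nonneg_right (min_le_right γ (1 / 2)) (sq_nonneg b)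
      rw [← hm] at h4 h5
      linarith
    have hKn : 0 ≤ ‖K φ‖ := (K φ).opNorm_nonneg
    have h6 : m * a ≤ ‖K φ‖ := by
      rcases ha.eq_or_lt with h0 | h0
      · rw [← h0, mul_zero]; exact hKn
      · refine le_of_mul_le_mul_right ?_ h0
        nlinarith [mul_nonneg hm0.le (sq_nonneg b)]
    -- From `h1` and `h6`: (m b)² ≤ m ‖K φ‖ a ≤ ‖K φ‖².
    have h7 : m * b ≤ ‖K φ‖ := by
      refine le_of_sq_le_sq ?_ hKn
      nlinarith [mul_le_mul_of_nonneg_left h6 hKn, mul_nonneg hm0.le (sq_nonneg a)]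
    have h8 : |L φ| ≤ ‖P F‖ * a + ‖v‖ * b := by
      rw [hL, ← pairingL_apply]
      exact (abs_add_le _ _).trans (add_le_add ((P F).le_opNorm _) (abs_real_inner_le_norm _ _))
    rw [div_mul_eq_mul_div, le_div_iff₀ hm0]
    have h9 := mul_le_mul_of_nonneg_left h6 (norm_nonneg (P F))
    have h10 := mul_le_mul_of_nonneg_left h7 (norm_nonneg v)
    have h11 := mul_le_mul_of_nonneg_right h8 hm0.le
    linarith
  refine ⟨y, fun φ => ?_⟩
  rw [← hK, hy, hL]

/-- Solvability of `σ y' + B y = F`, `y(e₀) = v` in `W(0,T;V)`. -/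
theorem exists_solution {T σ e₀ e₁ γ : ℝ} (hT : 0 < T) (ho : IsOrientation T σ e₀ e₁)
    (hγ : 0 < γ) {j : V →L[ℝ] H} (hj : DenseRange j) {B : L2 T V →L[ℝ] L2 T (StrongDual ℝ V)}
    (hB : ∀ y, γ * ‖y‖ ^ 2 ≤ pairing (B y) y) (F : L2 T (StrongDual ℝ V)) (v : H) :
    ∃ y z, IsTimeDeriv j y z ∧ σ • z + B y = F ∧ HasTrace j y e₀ v := by
  obtain ⟨y, hy⟩ := exists_weak_solution hT ho hγ j hB F v
  -- The equation forces this derivative, since σ² = 1; what must be proved is that it is the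
  -- distributional derivative of y.
  set z : L2 T (StrongDual ℝ V) := σ • (F - B y) with hz
  have hzp : ∀ φ, pairing z φ = σ * (pairing F φ - pairing (B y) φ) := fun φ => by
    simp only [hz, ← pairingL_apply, map_sub, map_smul, _root_.sub_apply, _root_.smul_apply,
      smul_eq_mul]
  have hde : ∀ φ : testSpace V e₁, pairing (testDeriv T e₁ j φ) y =
      -pairing z (testToL2 T e₁ φ) - σ * ⟪v, j ((φ : ℝ → V) e₀)⟫ := fun φ => by
    have h1 := hy φ
    have h2 := congrArg (fun x => σ * x) h1
    rw [hzp]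
    have h3 := ho.mul_self
    linear_combination (-1) * h2 - pairing (testDeriv T e₁ j φ) y * h3
  have hd : IsTimeDeriv j y z := fun θ hθ hc hs => by
    have hθ0 : ∀ x, x ∉ Ioo 0 T → θ x = 0 := fun x hx => by
      by_contra hne
      exact hx (hs (subset_tsupport θ hne))
    have he0 : θ e₀ = 0 ∧ θ e₁ = 0 := by
      rcases ho with ⟨-, rfl, rfl⟩ | ⟨-, rfl, rfl⟩
      · exact ⟨hθ0 _ fun h => lt_irrefl _ h.1, hθ0 _ fun h => lt_irrefl _ h.2⟩
      · exact ⟨hθ0 _ fun h => lt_irrefl _ h.2, hθ0 _ fun h => lt_irrefl _ h.1⟩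
    have hθ' : Continuous (deriv θ) := hθ.continuous_deriv (by simp)
    have i1 := integrable_smul_of_hasCompactSupport hθ' hc.deriv ((gelfand j).integrable_comp (L2.integrable y))
    have i2 := integrable_smul_of_hasCompactSupport hθ.continuous hc (L2.integrable z)
    ext w
    -- A scalar test function times w vanishes at both ends, so the datum v drops out.
    let φ : testSpace V e₁ := ⟨fun t => θ t • w,
      (hθ.of_le (by simp)).smul contDiff_const, by simp only [he0.2, zero_smul]⟩
    have h1 := hde φ
    have h2 : (φ : ℝ → V) e₀ = 0 := by simp only [φ, he0.1, zero_smul]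
    rw [h2, map_zero, inner_zero_right, mul_zero, sub_zero] at h1
    rw [_root_.neg_apply, ContinuousLinearMap.integral_apply i1,
      ContinuousLinearMap.integral_apply i2]
    have e1 : ∫ t, (deriv θ t • gelfand j (y t)) w ∂(timeMeasure T) =
        pairing (testDeriv T e₁ j φ) y := by
      refine integral_congr_ae ?_
      filter_upwards [coeFn_ofContinuous (T := T)
        ((gelfand j).continuous.comp (φ.2.1.continuous_deriv le_rfl))] with t ht
      change _ = (ofContinuous T ((gelfand j).continuous.comp (φ.2.1.continuous_deriv le_rfl)) t)
        (y t)
      rw [ht, Function.comp_apply]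
      have : deriv (φ : ℝ → V) t = deriv θ t • w :=
        (((hθ.differentiable (by simp)) t).hasDerivAt.smul_const w).deriv
      rw [this, map_smul, _root_.smul_apply, _root_.smul_apply, gelfand_apply, gelfand_apply,
        real_inner_comm]
    have e2 : ∫ t, (θ t • z t) w ∂(timeMeasure T) = pairing z (testToL2 T e₁ φ) := by
      refine integral_congr_ae ?_
      filter_upwards [coeFn_ofContinuous (T := T) φ.2.1.continuous] with t ht
      change _ = z t (ofContinuous T φ.2.1.continuous t)
      rw [ht, map_smul, _root_.smul_apply]
    rw [e1, e2, h1]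
  refine ⟨y, z, hd, ?_, ?_⟩
  · rw [hz, smul_smul, ho.mul_self, one_smul, sub_add_cancel]
  · obtain ⟨h₀, t₀⟩ := hd.exists_hasTrace hT e₀
    obtain ⟨h₁, t₁⟩ := hd.exists_hasTrace hT e₁
    suffices h₀ = v by rwa [← this]
    refine hj.induction_on (p := fun x => ⟪h₀ - v, x⟫ = 0) (h₀ - v) ?_ ?_ |> fun h =>
      sub_eq_zero.1 (inner_self_eq_zero.1 h)
    · exact isClosed_eq (by fun_prop) continuous_const
    · intro w
      -- This affine function takes the value w at e₀ and 0 at e₁, isolating ⟨h₀ - v, j w⟩; density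
      -- of the range of j then gives h₀ = v.
      let φ : testSpace V e₁ := ⟨fun t => ((t - e₁) / (e₀ - e₁)) • w,
        ((contDiff_id.sub contDiff_const).div_const _).smul contDiff_const, by simp⟩
      have hφ0 : (φ : ℝ → V) e₀ = w := by
        simp only [φ, div_self (ho.ne hT), one_smul]
      have h1 := ho.integration_by_parts hT hd (isTimeDeriv_derivClass hT j φ.2.1) t₀ t₁
        (hasTrace_ofContinuous (T := T) j φ.2.1.continuous e₀)
        (hasTrace_ofContinuous (T := T) j φ.2.1.continuous e₁)
      change _ = σ * (pairing z (testToL2 T e₁ φ) + pairing (testDeriv T e₁ j φ) y) at h1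
      rw [hde φ, hφ0, φ.2.2, map_zero, inner_zero_right] at h1
      rw [inner_sub_left]
      have h3 := ho.mul_self
      linear_combination (-1) * h1 + ⟪v, j w⟫ * h3

end Evolution

end InitialControl

/-- Minimisation of a strictly convex quadratic functional over a closed convex set. -/
theorem existsUnique_isMinOn_quadratic {H Y : Type*} [NormedAddCommGroup H] [InnerProductSpace ℝ H]
    [CompleteSpace H] [NormedAddCommGroup Y] [InnerProductSpace ℝ Y]
    (A : H →L[ℝ] Y) (d : Y) {α : ℝ} (hα : 0 < α) (b : H) {U : Set H} (hU : IsClosed U)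
    (hc : Convex ℝ U) (hne : U.Nonempty) (J : H → ℝ)
    (hJ : ∀ v, J v = 1 / 2 * ‖A v - d‖ ^ 2 + α / 2 * ‖v - b‖ ^ 2) :
    (∃! u, u ∈ U ∧ IsMinOn J U u) ∧ ∀ u ∈ U, IsMinOn J U u ↔
      ∀ v ∈ U, 0 ≤ ⟪A u - d, A (v - u)⟫ + α * ⟪u - b, v - u⟫ := by
  have hs0 : 0 < √α := Real.sqrt_pos.2 hα
  have hss : √α * √α = α := Real.mul_self_sqrt hα.le
  -- With Ψ v = (A v, √α v) and D = (d, √α b), J v is half the squared distance from D to Ψ v.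
  let Ψ : H →L[ℝ] WithLp 2 (Y × H) :=
    ((WithLp.prodContinuousLinearEquiv 2 ℝ Y H).symm : Y × H →L[ℝ] WithLp 2 (Y × H)) ∘L
      A.prod (√α • ContinuousLinearMap.id ℝ H)
  let D : WithLp 2 (Y × H) := WithLp.toLp 2 (d, √α • b)
  have hinner : ∀ u v w, ⟪D - Ψ u, Ψ v - Ψ w⟫ =
      -(⟪A u - d, A (v - w)⟫ + α * ⟪u - b, v - w⟫) := fun u v w => by
    rw [WithLp.prod_inner_apply]
    change ⟪d - A u, A v - A w⟫ + ⟪√α • b - √α • u, √α • v - √α • w⟫ = _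
    rw [← smul_sub, ← smul_sub, real_inner_smul_left, real_inner_smul_right, ← mul_assoc, hss,
      ← map_sub, ← neg_sub (A u) d, ← neg_sub u b, inner_neg_left, inner_neg_left]
    ring
  have hnorm : ∀ v, ‖D - Ψ v‖ ^ 2 = 2 * J v := fun v => by
    rw [hJ, WithLp.prod_norm_sq_eq_of_L2]
    change ‖d - A v‖ ^ 2 + ‖√α • b - √α • v‖ ^ 2 = _
    rw [← smul_sub, norm_smul, mul_pow, Real.norm_of_nonneg hs0.le, sq (√α), hss,
      norm_sub_rev d, norm_sub_rev b]
    ring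
  have hle : ∀ u v, ‖D - Ψ u‖ ≤ ‖D - Ψ v‖ ↔ J u ≤ J v := fun u v => by
    rw [← sq_le_sq₀ (norm_nonneg _) (norm_nonneg _), hnorm, hnorm]
    constructor <;> intro h <;> linarith
  have hanti : AntilipschitzWith (Real.toNNReal (√α)⁻¹) Ψ := by
    refine Ψ.antilipschitz_of_bound fun v => ?_
    have h1 : ‖Ψ v‖ ^ 2 = ‖A v‖ ^ 2 + ‖√α • v‖ ^ 2 := WithLp.prod_norm_sq_eq_of_L2 _
    have h2 : ‖√α • v‖ ≤ ‖Ψ v‖ := by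
      refine le_of_sq_le_sq ?_ (norm_nonneg _)
      rw [h1]
      linarith [sq_nonneg ‖A v‖]
    rw [norm_smul, Real.norm_of_nonneg hs0.le] at h2
    rw [Real.coe_toNNReal _ (inv_nonneg.2 hs0.le), le_inv_mul_iff₀ hs0]
    exact h2
  -- The second component bounds Ψ from below, so the image of U is complete even if Y is not.
  have hcomplete : IsComplete (Ψ '' U) :=
    (hanti.isUniformInducing Ψ.uniformContinuous).isComplete_iff.2 hU.isComplete
  have hconv : Convex ℝ (Ψ '' U) := hc.linear_image Ψ.toLinearMap
  have hmin : ∀ u ∈ U, IsMinOn J U u ↔ ‖D - Ψ u‖ = ⨅ w : Ψ '' U, ‖D - w‖ := fun u hu => by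
    have : Nonempty (Ψ '' U) := ⟨⟨Ψ u, u, hu, rfl⟩⟩
    have hbdd : BddBelow (range fun w : Ψ '' U => ‖D - w‖) :=
      ⟨0, by rintro _ ⟨w, rfl⟩; exact norm_nonneg _⟩
    rw [isMinOn_iff]
    constructor
    · intro h
      refine le_antisymm (le_ciInf ?_) (ciInf_le hbdd ⟨Ψ u, u, hu, rfl⟩)
      rintro ⟨_, v, hv, rfl⟩
      exact (hle u v).2 (h v hv)
    · intro h v hv
      rw [← hle, h]
      exact ciInf_le hbdd ⟨Ψ v, v, hv, rfl⟩
  have hvi : ∀ u ∈ U, IsMinOn J U u ↔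
      ∀ v ∈ U, 0 ≤ ⟪A u - d, A (v - u)⟫ + α * ⟪u - b, v - u⟫ := fun u hu => by
    rw [hmin u hu, norm_eq_iInf_iff_real_inner_le_zero hconv (mem_image_of_mem _ hu),
      forall_mem_image]
    refine forall₂_congr fun v _ => ?_
    rw [hinner, neg_nonpos]
  refine ⟨?_, hvi⟩
  obtain ⟨_, ⟨u, hu, rfl⟩, hun⟩ :=
    exists_norm_eq_iInf_of_complete_convex (hne.image Ψ) hcomplete hconv D
  refine ⟨u, ⟨hu, (hmin u hu).2 hun⟩, fun w hw => ?_⟩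
  have h1 := (hvi u hu).1 ((hmin u hu).2 hun) w hw.1
  have h2 := (hvi w hw.1).1 hw.2 u hu
  -- Adding the variational inequalities of two minimisers u and w leaves -‖A(w - u)‖² - α‖w - u‖² ≥
  -- 0.
  have h3 : ⟪A u - d, A (w - u)⟫ + ⟪A w - d, A (u - w)⟫ = -‖A (w - u)‖ ^ 2 := by
    rw [← neg_sub w u, map_neg, inner_neg_right, ← sub_eq_add_neg, ← inner_sub_left,
      ← real_inner_self_eq_norm_sq, ← inner_neg_left, map_sub]
    congr 1
    abel
  have h4 : ⟪u - b, w - u⟫ + ⟪w - b, u - w⟫ = -‖w - u‖ ^ 2 := by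
    rw [← neg_sub w u, inner_neg_right, ← sub_eq_add_neg, ← inner_sub_left,
      ← real_inner_self_eq_norm_sq, ← inner_neg_left]
    congr 1
    abel
  have h5 : α * ‖w - u‖ ^ 2 ≤ 0 := by
    have : α * ‖w - u‖ ^ 2 = -(α * ⟪u - b, w - u⟫ + α * ⟪w - b, u - w⟫) := by
      rw [← mul_add, h4]
      ring
    nlinarith [sq_nonneg ‖A (w - u)‖]
  have h6 : ‖w - u‖ ^ 2 ≤ 0 := by
    by_contra! h
    exact absurd h5 (not_le.2 (mul_pos hα h))
  exact sub_eq_zero.1 (norm_eq_zero.1 (pow_eq_zero_iff two_ne_zero |>.1 (le_antisymm h6 (sq_nonneg _))))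

namespace InitialControl

/-! ### Solution operators and uniqueness -/

section Control

variable {V H : Type*}
  [NormedAddCommGroup V] [InnerProductSpace ℝ V]
  [NormedAddCommGroup H] [InnerProductSpace ℝ H] [CompleteSpace H]

/-- `y ∈ W(0,T;V)` solves `σ y' + B y = F`, `y(e) = v`. -/
def IsSolution {T : ℝ} (j : V →L[ℝ] H) (B : L2 T V →L[ℝ] L2 T (StrongDual ℝ V)) (σ e : ℝ)
    (F : L2 T (StrongDual ℝ V)) (v : H) (y : L2 T V) : Prop :=
  ∃ z, IsTimeDeriv j y z ∧ σ • z + B y = F ∧ HasTrace j y e v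

omit [CompleteSpace H] in
theorem IsSolution.add {T : ℝ} {j : V →L[ℝ] H} {B : L2 T V →L[ℝ] L2 T (StrongDual ℝ V)} {σ e : ℝ}
    {F₁ F₂ : L2 T (StrongDual ℝ V)} {v₁ v₂ : H} {y₁ y₂ : L2 T V}
    (h₁ : IsSolution j B σ e F₁ v₁ y₁) (h₂ : IsSolution j B σ e F₂ v₂ y₂) :
    IsSolution j B σ e (F₁ + F₂) (v₁ + v₂) (y₁ + y₂) := by
  obtain ⟨z₁, a₁, b₁, c₁⟩ := h₁
  obtain ⟨z₂, a₂, b₂, c₂⟩ := h₂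
  refine ⟨z₁ + z₂, a₁.add a₂, ?_, c₁.add c₂⟩
  rw [← b₁, ← b₂, smul_add, map_add]
  abel

omit [CompleteSpace H] in
theorem IsSolution.const_smul {T : ℝ} {j : V →L[ℝ] H} {B : L2 T V →L[ℝ] L2 T (StrongDual ℝ V)}
    {σ e : ℝ} {F : L2 T (StrongDual ℝ V)} {v : H} {y : L2 T V}
    (h : IsSolution j B σ e F v y) (c : ℝ) : IsSolution j B σ e (c • F) (c • v) (c • y) := by
  obtain ⟨z, h1, h2, h3⟩ := h
  refine ⟨c • z, h1.const_smul c, ?_, h3.const_smul c⟩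
  rw [← h2, smul_add, map_smul, smul_comm]

/-- The difference solves the homogeneous equation with zero datum, so the a priori estimate makes
it vanish. -/
theorem IsSolution.unique {T σ e₀ e₁ γ : ℝ} (hT : 0 < T) (ho : IsOrientation T σ e₀ e₁)
    (hγ : 0 < γ) {j : V →L[ℝ] H} {B : L2 T V →L[ℝ] L2 T (StrongDual ℝ V)}
    (hB : ∀ y, γ * ‖y‖ ^ 2 ≤ pairing (B y) y) {F : L2 T (StrongDual ℝ V)} {v : H} {y₁ y₂ : L2 T V}
    (h₁ : IsSolution j B σ e₀ F v y₁) (h₂ : IsSolution j B σ e₀ F v y₂) : y₁ = y₂ := by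
  obtain ⟨z, a, b, c⟩ := h₁.add (h₂.const_smul (-1))
  simp only [neg_smul, one_smul, add_neg_cancel] at a b c
  have h := norm_sq_le_of_homogeneous hT ho hB a b c
  rw [norm_zero, ← sub_eq_add_neg] at h
  have h6 : ‖y₁ - y₂‖ ^ 2 ≤ 0 := by
    by_contra! hn
    have := mul_pos (mul_pos two_pos hγ) hn
    simp only [ne_eq, OfNat.ofNat_ne_zero, not_false_eq_true, zero_pow] at h
    linarith
  exact sub_eq_zero.1 (norm_eq_zero.1
    (pow_eq_zero_iff two_ne_zero |>.1 (le_antisymm h6 (sq_nonneg _))))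

variable [CompleteSpace V]

/-- The linear solution operator of the homogeneous equation. -/
theorem exists_solution_operator {T σ e₀ e₁ γ : ℝ} (hT : 0 < T) (ho : IsOrientation T σ e₀ e₁)
    (hγ : 0 < γ) {j : V →L[ℝ] H} (hj : DenseRange j) {B : L2 T V →L[ℝ] L2 T (StrongDual ℝ V)}
    (hB : ∀ y, γ * ‖y‖ ^ 2 ≤ pairing (B y) y) :
    ∃ S : H →L[ℝ] L2 T V, ∀ v, IsSolution j B σ e₀ 0 v (S v) := by
  have hex : ∀ v, ∃ y, IsSolution j B σ e₀ 0 v y := fun v => exists_solution hT ho hγ hj hB 0 v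
  choose S hS using hex
  let S₀ : H →ₗ[ℝ] L2 T V :=
    { toFun := S
      map_add' := fun v w => by
        have h := (hS v).add (hS w)
        rw [add_zero] at h
        exact (hS (v + w)).unique hT ho hγ hB h
      map_smul' := fun c v => by
        have h := (hS v).const_smul c
        rw [smul_zero] at h
        exact (hS (c • v)).unique hT ho hγ hB h }
  -- The constant comes from the a priori estimate 2γ‖y‖² ≤ ‖v‖².
  refine ⟨S₀.mkContinuous (√(2 * γ))⁻¹ fun v => ?_, hS⟩
  obtain ⟨z, h1, h2, h3⟩ := hS v
  have h := norm_sq_le_of_homogeneous hT ho hB h1 h2 h3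
  have hs : 0 < √(2 * γ) := Real.sqrt_pos.2 (by positivity)
  rw [le_inv_mul_iff₀ hs]
  refine le_of_sq_le_sq ?_ (norm_nonneg _)
  rw [mul_pow, Real.sq_sqrt (by positivity)]
  exact h

omit [CompleteSpace H] [CompleteSpace V] in
theorem pairing_operator {T : ℝ} {b : ℝ → V →L[ℝ] StrongDual ℝ V}
    {B : L2 T V →L[ℝ] L2 T (StrongDual ℝ V)}
    (hB : ∀ y, ∀ᵐ t ∂(timeMeasure T), B y t = b t (y t)) (y φ : L2 T V) :
    pairing (B y) φ = ∫ t, b t (y t) (φ t) ∂(timeMeasure T) := by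
  refine integral_congr_ae ?_
  filter_upwards [hB y] with t ht
  rw [ht]

omit [CompleteSpace V] in
theorem coercive_operator {T γ : ℝ} {b : ℝ → V →L[ℝ] StrongDual ℝ V}
    {B : L2 T V →L[ℝ] L2 T (StrongDual ℝ V)}
    (hB : ∀ y, ∀ᵐ t ∂(timeMeasure T), B y t = b t (y t))
    (hb : ∀ t ∈ Ioc 0 T, ∀ ψ : V, γ * ‖ψ‖ ^ 2 ≤ b t ψ ψ) (y : L2 T V) :
    γ * ‖y‖ ^ 2 ≤ pairing (B y) y := by
  rw [L2.norm_sq_eq, ← integral_const_mul]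
  refine integral_mono_ae ((L2.integrable_norm_sq y).const_mul γ)
    (integrable_dual_apply (Lp.memLp _) (Lp.memLp _)) ?_
  filter_upwards [hB y, ae_restrict_mem measurableSet_Ioc] with t ht hm
  rw [ht]
  exact hb t hm _

end Control

end InitialControl

/-! ### The optimality system -/

theorem mainTheorem1 {V H Y : Type*}
    [NormedAddCommGroup V] [InnerProductSpace ℝ V] [CompleteSpace V]
    [TopologicalSpace.SeparableSpace V]
    [NormedAddCommGroup H] [InnerProductSpace ℝ H] [CompleteSpace H]
    [TopologicalSpace.SeparableSpace H]
    [NormedAddCommGroup Y] [InnerProductSpace ℝ Y] [CompleteSpace Y]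
    (j : V →L[ℝ] H) (hj : Function.Injective j) (hj' : DenseRange j)
    (T : ℝ) (hT : 0 < T)
    (a : ℝ → V →L[ℝ] StrongDual ℝ V) (c γ : ℝ) (hγ : 0 < γ)
    (ha_bdd : ∀ t ∈ Ioc 0 T, ∀ φ ψ : V, |a t φ ψ| ≤ c * ‖φ‖ * ‖ψ‖)
    (ha_ell : ∀ t ∈ Ioc 0 T, ∀ ψ : V, γ * ‖ψ‖ ^ 2 ≤ a t ψ ψ)
    (ha_meas : ∀ φ ψ : V, AEMeasurable (fun t => a t φ ψ) (InitialControl.timeMeasure T))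
    (f : InitialControl.L2 T (StrongDual ℝ V))
    (C : InitialControl.L2 T V →L[ℝ] Y) (yd : Y)
    (α : ℝ) (hα : 0 < α) (yb : H)
    (U : Set H) (hU_closed : IsClosed U) (hU_convex : Convex ℝ U) (hU_nonempty : U.Nonempty) :
    -- the control-to-state map `v ↦ y(v)`, the adjoint `v ↦ p(v)` and its trace `v ↦ p(0;v)`
    ∃ (y p : H → InitialControl.L2 T V) (p₀ : H → H),
      (∀ v z, InitialControl.IsState j a f v z ↔ z = y v) ∧
      (∀ v q, InitialControl.IsAdjoint j a C yd (y v) q ↔ q = p v) ∧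
      (∀ v h, InitialControl.HasTrace j (p v) 0 h ↔ h = p₀ v) ∧
      (∃! u, u ∈ U ∧ IsMinOn (InitialControl.cost C yd α yb y) U u) ∧
      (∀ u ∈ U, IsMinOn (InitialControl.cost C yd α yb y) U u ↔
        ∀ v ∈ U, 0 ≤ ⟪p₀ u + α • (u - yb), v - u⟫) := by
  open InitialControl in
  have hfwd : IsOrientation T 1 0 T := Or.inl ⟨rfl, rfl, rfl⟩
  have hbwd : IsOrientation T (-1) T 0 := Or.inr ⟨rfl, rfl, rfl⟩
  have h0T : (0 : ℝ) ∈ Icc 0 T := left_mem_Icc.2 hT.le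
  obtain ⟨B, hBe⟩ := exists_operator ha_bdd ha_meas
  obtain ⟨B', hBe'⟩ := exists_operator (b := fun t => (a t).flip) (c := c)
    (fun t ht φ ψ => (ha_bdd t ht ψ φ).trans_eq (by ring)) fun φ ψ => ha_meas ψ φ
  have hB := coercive_operator hBe ha_ell
  have hB' := coercive_operator (b := fun t => (a t).flip) hBe' ha_ell
  have hp := pairing_operator hBe
  have hp' := pairing_operator (b := fun t => (a t).flip) hBe'
  -- B' is the transpose of B; this cancels the operator terms in the gradient formula.
  have hflip : ∀ φ ψ, pairing (B' φ) ψ = pairing (B ψ) φ := fun φ ψ => by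
    rw [hp, hp']
    rfl
  have hstate : ∀ v z, IsState j a f v z ↔ IsSolution j B 1 0 f v z := fun v z => by
    constructor
    · rintro ⟨⟨z', h1, h2⟩, h3⟩
      refine ⟨z', h1, eq_of_pairing_eq fun φ => ?_, h3⟩
      rw [← h2 φ, ← hp, one_smul, ← pairingL_apply, map_add, _root_.add_apply, pairingL_apply,
        pairingL_apply]
    · rintro ⟨z', h1, h2, h3⟩
      refine ⟨⟨z', h1, fun φ => ?_⟩, h3⟩
      rw [← h2, ← hp, one_smul, ← pairingL_apply, ← pairingL_apply, ← pairingL_apply, map_add,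
        _root_.add_apply]
  have hR : ∀ z, ∃ R : L2 T (StrongDual ℝ V), ∀ φ, pairing R φ = ⟪C z - yd, C φ⟫ := fun z =>
    exists_pairing_eq ((innerSL ℝ (C z - yd)) ∘L C)
  choose R hR using hR
  have hadj : ∀ z q, IsAdjoint j a C yd z q ↔ IsSolution j B' (-1) T (R z) 0 q := fun z q => by
    constructor
    · rintro ⟨⟨q', h1, h2⟩, h3⟩
      refine ⟨q', h1, eq_of_pairing_eq fun φ => ?_, h3⟩
      rw [hR, ← h2 φ, ← hp', neg_one_smul, ← pairingL_apply, map_add, map_neg, _root_.add_apply,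
        _root_.neg_apply, pairingL_apply, pairingL_apply]
    · rintro ⟨q', h1, h2, h3⟩
      refine ⟨⟨q', h1, fun φ => ?_⟩, h3⟩
      rw [← hR, ← h2, ← hp', neg_one_smul, ← pairingL_apply, ← pairingL_apply, ← pairingL_apply,
        map_add, map_neg, _root_.add_apply, _root_.neg_apply]
  obtain ⟨S, hS⟩ := exists_solution_operator hT hfwd hγ hj' hB
  obtain ⟨y₀, hy₀⟩ : ∃ y, IsSolution j B 1 0 f 0 y := exists_solution hT hfwd hγ hj' hB f 0
  have hy : ∀ v, IsSolution j B 1 0 f v (y₀ + S v) := fun v => by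
    have := hy₀.add (hS v)
    rwa [add_zero, zero_add] at this
  have hpex : ∀ v, ∃ q, IsSolution j B' (-1) T (R (y₀ + S v)) 0 q := fun v =>
    exists_solution hT hbwd hγ hj' hB' _ 0
  choose p hpv using hpex
  have htr : ∀ v, ∃ h, HasTrace j (p v) 0 h := fun v => by
    obtain ⟨q', h1, -, -⟩ := hpv v
    exact h1.exists_hasTrace hT 0
  choose p₀ hp₀ using htr
  -- Integration by parts of S w (value w at 0) against p u (value 0 at T), with each equation
  -- tested by the other's solution.
  have hgrad : ∀ u w, ⟪p₀ u, w⟫ = ⟪C (y₀ + S u) - yd, C (S w)⟫ := fun u w => by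
    obtain ⟨q', a1, a2, a3⟩ := hpv u
    obtain ⟨z, b1, b2, b3⟩ := hS w
    obtain ⟨k, b4⟩ := b1.exists_hasTrace hT T
    have h := b1.integration_by_parts hT a1 b3 b4 (hp₀ u) a3
    rw [inner_zero_right, real_inner_comm] at h
    have e1 := congrArg (fun x => pairingL T V x (S w)) a2
    have e2 := congrArg (fun x => pairingL T V x (p u)) b2
    simp only [map_add, map_smul, _root_.add_apply, _root_.smul_apply, map_zero,
      _root_.zero_apply, pairingL_apply, smul_eq_mul, hR, hflip] at e1 e2
    rw [map_add]
    linarith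
  -- The affine part C y₀ is absorbed into the target, leaving the linear map C ∘ S.
  have hmain := existsUnique_isMinOn_quadratic (C ∘L S) (yd - C y₀) hα yb hU_closed hU_convex
    hU_nonempty (cost C yd α yb fun v => y₀ + S v) fun v => by
      have : (C ∘L S) v - (yd - C y₀) = C (y₀ + S v) - yd := by
        rw [map_add, ContinuousLinearMap.comp_apply]
        abel
      rw [this]
      rfl
  refine ⟨fun v => y₀ + S v, p, p₀, fun v z => ?_, fun v q => ?_, fun v h => ?_, hmain.1,
    fun u hu => ?_⟩
  · rw [hstate]
    exact ⟨fun h => h.unique hT hfwd hγ hB (hy v), fun h => h ▸ hy v⟩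
  · rw [hadj]
    exact ⟨fun h => h.unique hT hbwd hγ hB' (hpv v), fun h => h ▸ hpv v⟩
  · exact ⟨fun h' => h'.unique hT h0T (hp₀ v), fun h' => h' ▸ hp₀ v⟩
  · rw [hmain.2 u hu]
    refine forall₂_congr fun v _ => ?_
    have : (C ∘L S) u - (yd - C y₀) = C (y₀ + S u) - yd := by
      rw [map_add, ContinuousLinearMap.comp_apply]
      abel
    rw [inner_add_left, hgrad, real_inner_smul_left, this]
    rfl
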